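/- A Cantor space is a nonempty, zero-dimensional, perfect, compact metrizable space $X$. A Borel probability measure $\mu$ on $X$ is good if it is atomless, has full support, and whenever $A,B\subseteq X$ are clopen with $\mu(A)\le\mu(B)$ there is a clopen $C\subseteq B$ with $\mu(C)=\mu(A)$. Its clopen value set is $V(\mu)=\{\mu(A): A\subseteq X \text{ clopen}\}$. Let $H_\mu$ be the group of homeomorphisms of $X$ preserving $\mu$, with the topology induced from the topology on $\mathrm{Homeo}(X)$ whose basic open sets are $\{g : g(U_1)=W_1,\dots,g(U_k)=W_k\}$ with $U_l,W_l$ clopen. A countable set $V\subseteq[0,1]$ is group-like if $V$ is not contained in $\frac1p\mathbb Z$ for any nonzero integer $p$ and $V$ equals the intersection of $[0,1]$ with the subgroup of $(\mathbb R,+)$ generated by $V\cup\{1\}$. Proposition. Let $V\subseteq[0,1]$ be group-like, and let $\mu_V$ be a good measure on a Cantor space with clopen value set $V$ (any such measure, on any Cantor space). Then $H_{\mu_V}$ has a dense conjugacy class if and only if $V$ satisfies the following condition: (*) whenever $a_1,\dots,a_p,b_1,\dots,b_q\in V$ and $n_1,\dots,n_p,m_1,\dots,m_q\in\mathbb N$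 are such that $\sum_{i=1}^p n_ia_i=1=\sum_{j=1}^q m_jb_j$, there exist $c_{i,j}\in V$ ($1\le i\le p$, $1\le j\le q$) such that $$\forall j\quad m_jb_j=\sum_{i=1}^p \operatorname{lcm}(n_i,m_j)\,c_{i,j}\qquad\text{and}\qquad \forall i\quad n_ia_i=\sum_{j=1}^q\operatorname{lcm}(n_i,m_j)\,c_{i,j}.$$ Moreover, condition (*) holds whenever $V+\mathbb Z$ is a $\mathbb Q$-vector subspace of $\mathbb R$, and whenever $V+\mathbb Z$ is a subring of $\mathbb R$. -/

import Mathlib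

open MeasureTheory TopologicalSpace Set
open scoped Pointwise

/-- A Cantor space: a nonempty, zero-dimensional, perfect, compact metrizable space. -/
structure IsCantorSpace (X : Type*) [TopologicalSpace X] : Prop where
  nonempty : Nonempty X
  compact : CompactSpace X
  metrizable : MetrizableSpace X
  /-- zero-dimensional: the clopen sets form a basis of the topology -/
  zeroDim : IsTopologicalBasis {U : Set X | IsClopen U}
  /-- perfect: no isolated points -/
  perfect : PerfectSpace X

/-- A good measure: an atomless Borel probability measure of full support such that, for clopen
sets `A`, `B` with `μ A ≤ μ B`, some clopen subset of `B` has the same measure as `A`. -/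
structure IsGoodMeasure {X : Type*} [TopologicalSpace X] [MeasurableSpace X]
    (μ : Measure X) : Prop where
  isProbability : IsProbabilityMeasure μ
  atomless : ∀ x : X, μ {x} = 0
  fullSupport : ∀ U : Set X, IsOpen U → U.Nonempty → μ U ≠ 0
  subset_condition : ∀ A B : Set X, IsClopen A → IsClopen B → μ A ≤ μ B →
    ∃ C : Set X, IsClopen C ∧ C ⊆ B ∧ μ C = μ A

/-- The clopen value set of a measure. -/
def clopenValueSet {X : Type*} [TopologicalSpace X] [MeasurableSpace X]
    (μ : Measure X) : Set ℝ :=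
  {r : ℝ | ∃ A : Set X, IsClopen A ∧ μ.real A = r}

/-- `⟨V⟩`: the intersection with `[0,1]` of the subgroup of `(ℝ, +)` generated by `V ∪ {1}`. -/
def unitGroupHull (V : Set ℝ) : Set ℝ :=
  (AddSubgroup.closure (V ∪ {1}) : Set ℝ) ∩ Icc 0 1

/-- A countable `V ⊆ [0,1]` is group-like if it is contained in no `(1/p)ℤ` and `V = ⟨V⟩`. -/
structure IsGroupLike (V : Set ℝ) : Prop where
  countable : V.Countable
  subset_Icc : V ⊆ Icc 0 1
  not_subset : ∀ p : ℤ, p ≠ 0 → ¬ V ⊆ {x : ℝ | ∃ k : ℤ, x = 1 / (p : ℝ) * (k : ℝ)}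
  eq_hull : V = unitGroupHull V

/-- The topology on the homeomorphism group for which the finite intersections of the sets
`{g | g(U) = W}`, with `U`, `W` clopen, form a basis. -/
instance homeoClopenTopology (X : Type*) [TopologicalSpace X] : TopologicalSpace (X ≃ₜ X) :=
  generateFrom {S : Set (X ≃ₜ X) | ∃ U W : Set X, IsClopen U ∧ IsClopen W ∧
    S = {g : X ≃ₜ X | g '' U = W}}

/-- `H_μ`: the group of homeomorphisms of `X` which preserve `μ`; it carries the subspace
topology. -/
def preservingHomeo {X : Type*} [TopologicalSpace X] [MeasurableSpace X] [BorelSpace X]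
    (μ : Measure X) : Subgroup (X ≃ₜ X) where
  carrier := {g : X ≃ₜ X | MeasurePreserving g μ μ}
  one_mem' := MeasurePreserving.id μ
  mul_mem' := fun {_ _} hg hh => (MeasurePreserving.comp (μb := μ) hg hh : MeasurePreserving (_ ∘ _) μ μ)
  inv_mem' := fun {g} hg => MeasurePreserving.symm g.toMeasurableEquiv hg

/-- A group with a topology has a dense conjugacy class. -/
def HasDenseConjugacyClass (G : Type*) [Group G] [TopologicalSpace G] : Prop :=
  ∃ g : G, Dense (conjugatesOf g)

/-- The lcm-decomposition condition on a set `V` of reals. -/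
def LcmCondition (V : Set ℝ) : Prop :=
  ∀ (p q : ℕ) (a : Fin p → ℝ) (b : Fin q → ℝ) (n : Fin p → ℕ) (m : Fin q → ℕ),
    (∀ i, a i ∈ V) → (∀ j, b j ∈ V) →
    ∑ i, (n i : ℝ) * a i = 1 → ∑ j, (m j : ℝ) * b j = 1 →
    ∃ c : Fin p → Fin q → ℝ, (∀ i j, c i j ∈ V) ∧
      (∀ j, (m j : ℝ) * b j = ∑ i, (Nat.lcm (n i) (m j) : ℝ) * c i j) ∧
      (∀ i, (n i : ℝ) * a i = ∑ j, (Nat.lcm (n i) (m j) : ℝ) * c i j)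

/-- The set `V + ℤ ⊆ ℝ`. -/
def addInt (V : Set ℝ) : Set ℝ := V + range (fun k : ℤ => (k : ℝ))

/-!
Let `H_μ` act on the clopen algebra of `X`. For a good measure, this is a homogeneous measured
Boolean algebra: a back-and-forth construction extends every finite partial isomorphism (a
measure-preserving matching of the pieces of two finite clopen partitions) to an element of `H_μ`
(`exists_generic_extension`, `exists_extends`), and the extensions of finite partial isomorphisms
form a basis of the topology (`isOpen_setOf_extends`, `exists_extends_subset_of_isOpen`).

A finite partial isomorphism defines a flow between its pieces, with values the measures of the
intersections of image pieces with domain pieces. It is a circulation with values in the group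
generated by `V ∪ {1}`. Such a circulation is a sum of cycles with weights in the same group
(`exists_weighted_perm_of_circulation`). Hence every finite partial isomorphism is refined by a
cyclic one, which permutes the pieces of a single partition
(`FinitePartialIso.exists_cyclic_refinement`). So the local data are finite permutations with
invariant weights in `V` of total mass `1`.

Two cyclic partial isomorphisms can be realised simultaneously, up to conjugacy, if and only if the
corresponding weighted permutations have an invariant joining with weights in `V`. If all such
joinings exist, the same generic construction produces an element of `H_μ` whose conjugates extend
every finite partial isomorphism, so that its conjugacy class is dense
(`HasInvariantJoinings.hasDenseConjugacyClass`). Conversely, an element with a dense conjugacy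
class realises all weighted permutations on suitable partitions, and the measures of the
intersections of the pieces of two such partitions give a joining
(`HasDenseConjugacyClass.hasInvariantJoinings`).

Finally, the product of a cycle of length `n` and a cycle of length `m` splits into cycles of
length `lcm n m`. Summing a joining over these cycles turns the existence of joinings into the lcm
condition (`HasInvariantJoinings.lcmCondition`, `HasInvariantJoinings.of_lcmCondition`).

For the last two assertions, put `c i j = d i j / lcm (n i) (m j)` in the case of a rational vector
space, where `d` is a matrix over `V` with row sums `n i * a i` and column sums `m j * b j`; and
`c i j = gcd (n i) (m j) * a i * b j` in the case of a subring.
-/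

/-! ### Orbits of permutations of finite sets -/

open Equiv.Perm Function in
/-- The cycle of `x` under a permutation has as many elements as the period of `x`. -/
lemma card_sameCycle_eq_minimalPeriod {T : Type*} [Fintype T] (ρ : Equiv.Perm T) (x : T)
    [DecidablePred fun y => SameCycle ρ x y] :
    (Finset.univ.filter fun y => SameCycle ρ x y).card = minimalPeriod ρ x := by
  classical
  have h := MulAction.minimalPeriod_eq_card (a := ρ) (b := x)
  have h2 : (ρ • · : T → T) = ρ := rfl
  rw [h2] at h
  rw [h, ← Fintype.card_subtype]
  refine Fintype.card_congr (Equiv.subtypeEquivRight fun y => ?_)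
  constructor
  · rintro ⟨i, hi⟩
    exact ⟨⟨ρ ^ i, i, rfl⟩, hi⟩
  · rintro ⟨⟨_, i, rfl⟩, hi⟩
    exact ⟨i, hi⟩

/-- The set of cycles (fixed points included) of a permutation. -/
abbrev Cycles {T : Type*} (ρ : Equiv.Perm T) : Type _ :=
  Quotient (Equiv.Perm.SameCycle.setoid ρ)

noncomputable instance {T : Type*} [Fintype T] (ρ : Equiv.Perm T) : Fintype (Cycles ρ) :=
  Fintype.ofFinite _

/-- The length of a cycle. -/
noncomputable def cycleLength {T : Type*} (ρ : Equiv.Perm T) (q : Cycles ρ) : ℕ :=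
  Function.minimalPeriod ρ q.out

lemma invariant_of_sameCycle {T M : Type*} {ρ : Equiv.Perm T} {f : T → M}
    (hf : ∀ x, f (ρ x) = f x) {x y : T} (h : Equiv.Perm.SameCycle ρ x y) : f x = f y := by
  obtain ⟨i, rfl⟩ := h
  have hinv : ∀ x, f (ρ⁻¹ x) = f x := fun x => by
    rw [← hf (ρ⁻¹ x)]
    exact congrArg f (Equiv.apply_symm_apply ρ x)
  induction i using Int.induction_on generalizing x with
  | zero => simp
  | succ i ih => rw [zpow_add, zpow_one, Equiv.Perm.mul_apply, ← ih, hf]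
  | pred i ih => rw [zpow_sub, zpow_one, Equiv.Perm.mul_apply, ← ih, hinv]

lemma sum_cycle_eq {T : Type*} [Fintype T] [DecidableEq T] (ρ : Equiv.Perm T) {f : T → ℝ}
    (hf : ∀ x, f (ρ x) = f x) (q : Cycles ρ) [DecidablePred fun x : T => (⟦x⟧ : Cycles ρ) = q] :
    ∑ x with (⟦x⟧ : Cycles ρ) = q, f x = cycleLength ρ q * f q.out := by
  classical
  have h1 : (Finset.univ.filter fun x : T => (⟦x⟧ : Cycles ρ) = q)
      = Finset.univ.filter fun y => Equiv.Perm.SameCycle ρ q.out y := by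
    ext x
    simp only [Finset.mem_filter, Finset.mem_univ, true_and]
    conv_lhs => rw [← q.out_eq]
    rw [Quotient.eq]
    exact Equiv.Perm.sameCycle_comm
  have h2 : ∀ x ∈ (Finset.univ.filter fun y => Equiv.Perm.SameCycle ρ q.out y),
      f x = f q.out := by
    intro x hx
    exact (invariant_of_sameCycle hf (Finset.mem_filter.1 hx).2).symm
  rw [h1, Finset.sum_congr rfl h2, Finset.sum_const, card_sameCycle_eq_minimalPeriod]
  simp [cycleLength]

/-- The sum of an invariant function, computed cycle by cycle. -/
lemma sum_eq_sum_cycles {T : Type*} [Fintype T] (ρ : Equiv.Perm T) {f : T → ℝ}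
    (hf : ∀ x, f (ρ x) = f x) :
    ∑ x, f x = ∑ q : Cycles ρ, (cycleLength ρ q : ℝ) * f q.out := by
  classical
  rw [← Finset.sum_fiberwise (s := Finset.univ) (g := fun x : T => (⟦x⟧ : Cycles ρ))]
  exact Finset.sum_congr rfl fun q _ => sum_cycle_eq ρ hf q

lemma cycleLength_pos {T : Type*} [Fintype T] (ρ : Equiv.Perm T) (q : Cycles ρ) :
    0 < cycleLength ρ q :=
  Function.minimalPeriod_pos_of_mem_periodicPts (ρ.injective.mem_periodicPts _)

/-! ### Invariant joinings of weighted permutations -/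

/-- Any two finite weighted permutations with weights in `V` have an invariant joining with
weights in `V`. Here a weighted permutation is a permutation `σ` of a finite set together with a
`σ`-invariant weight `a` of total mass `1`, and a joining of `(σ, a)` and `(τ, b)` is a weight on
the product, invariant under `σ × τ`, with marginals `a` and `b`. -/
def HasInvariantJoinings.{u, v} (V : Set ℝ) : Prop :=
  ∀ (ι : Type u) (κ : Type v) [Fintype ι] [Fintype κ] (σ : Equiv.Perm ι) (τ : Equiv.Perm κ)
    (a : ι → ℝ) (b : κ → ℝ), (∀ x, a x ∈ V) → (∀ y, b y ∈ V) →
    (∀ x, a (σ x) = a x) → (∀ y, b (τ y) = b y) → ∑ x, a x = 1 → ∑ y, b y = 1 →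
    ∃ c : ι → κ → ℝ, (∀ x y, c x y ∈ V) ∧ (∀ x y, c (σ x) (τ y) = c x y) ∧
      (∀ x, ∑ y, c x y = a x) ∧ (∀ y, ∑ x, c x y = b y)

lemma LcmCondition.of_fintype {V : Set ℝ} (hV : LcmCondition V) {P Q : Type*} [Fintype P]
    [Fintype Q] (a : P → ℝ) (b : Q → ℝ) (n : P → ℕ) (m : Q → ℕ) (ha : ∀ i, a i ∈ V)
    (hb : ∀ j, b j ∈ V) (hna : ∑ i, (n i : ℝ) * a i = 1) (hmb : ∑ j, (m j : ℝ) * b j = 1) :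
    ∃ c : P → Q → ℝ, (∀ i j, c i j ∈ V) ∧
      (∀ j, (m j : ℝ) * b j = ∑ i, (Nat.lcm (n i) (m j) : ℝ) * c i j) ∧
      (∀ i, (n i : ℝ) * a i = ∑ j, (Nat.lcm (n i) (m j) : ℝ) * c i j) := by
  let e := Fintype.equivFin P
  let f := Fintype.equivFin Q
  obtain ⟨c, hc, h1, h2⟩ := hV _ _ (a ∘ e.symm) (b ∘ f.symm) (n ∘ e.symm) (m ∘ f.symm)
    (fun _ => ha _) (fun _ => hb _)
    (by rw [← hna]; exact Equiv.sum_comp e.symm fun i => (n i : ℝ) * a i)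
    (by rw [← hmb]; exact Equiv.sum_comp f.symm fun j => (m j : ℝ) * b j)
  refine ⟨fun i j => c (e i) (f j), fun i j => hc _ _, fun j => ?_, fun i => ?_⟩
  · have := h1 (f j)
    rw [← Equiv.sum_comp e] at this
    simpa using this
  · have := h2 (e i)
    rw [← Equiv.sum_comp f] at this
    simpa using this

open Equiv.Perm in
/-- The product of a cycle of `σ` and a cycle of `τ` contains the cycle under `σ × τ` of the pair
of their base points. Its length is the least common multiple of the two lengths. -/
lemma card_product_cycle {ι κ : Type*} [Fintype ι] [Fintype κ] [DecidableEq ι] [DecidableEq κ]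
    (σ : Equiv.Perm ι) (τ : Equiv.Perm κ) (x : ι) (y : κ)
    [DecidablePred fun p : ι × κ => SameCycle (σ.prodCongr τ : Equiv.Perm (ι × κ)) (x, y) p] :
    (Finset.univ.filter fun p : ι × κ =>
      SameCycle (σ.prodCongr τ : Equiv.Perm (ι × κ)) (x, y) p).card
      = Nat.lcm (Function.minimalPeriod σ x) (Function.minimalPeriod τ y) := by
  rw [card_sameCycle_eq_minimalPeriod]
  exact Function.minimalPeriod_prodMap σ τ (x, y)

lemma prodCongr_zpow_apply {ι κ : Type*} (σ : Equiv.Perm ι) (τ : Equiv.Perm κ) (i : ℤ)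
    (p : ι × κ) :
    ((σ.prodCongr τ : Equiv.Perm (ι × κ)) ^ i) p = ((σ ^ i) p.1, (τ ^ i) p.2) := by
  induction i using Int.induction_on generalizing p with
  | zero => simp
  | succ i ih => simp only [zpow_add, zpow_one, Equiv.Perm.mul_apply, ih]; rfl
  | pred i ih => simp only [zpow_sub, zpow_one, Equiv.Perm.mul_apply, ih]; rfl

/-- A joining is obtained by putting, for each pair of cycles, the weight provided by the lcm
condition on one single cycle of the product. -/
theorem HasInvariantJoinings.of_lcmCondition {V : Set ℝ} (h0 : (0 : ℝ) ∈ V)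
    (hV : LcmCondition V) : HasInvariantJoinings V := by
  classical
  intro ι κ _ _ σ τ a b ha hb hσ hτ hsa hsb
  obtain ⟨c, hc, h1, h2⟩ := hV.of_fintype (P := Cycles σ) (Q := Cycles τ)
    (fun q => a q.out) (fun q => b q.out) (cycleLength σ) (cycleLength τ)
    (fun _ => ha _) (fun _ => hb _) (by rw [← sum_eq_sum_cycles σ hσ, hsa])
    (by rw [← sum_eq_sum_cycles τ hτ, hsb])
  let ρ : Equiv.Perm (ι × κ) := σ.prodCongr τ
  have hqσ : ∀ x, (⟦σ x⟧ : Cycles σ) = ⟦x⟧ := fun x =>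
    Quotient.sound (Equiv.Perm.sameCycle_apply_left.2 (Equiv.Perm.SameCycle.refl _ _))
  have hqτ : ∀ x, (⟦τ x⟧ : Cycles τ) = ⟦x⟧ := fun x =>
    Quotient.sound (Equiv.Perm.sameCycle_apply_left.2 (Equiv.Perm.SameCycle.refl _ _))
  let d : ι → κ → ℝ := fun x y =>
    if ρ.SameCycle ((⟦x⟧ : Cycles σ).out, (⟦y⟧ : Cycles τ).out) (x, y) then
      c ⟦x⟧ ⟦y⟧ else 0
  have hd : ∀ x y, d (σ x) (τ y) = d x y := by
    intro x y
    simp only [d, hqσ, hqτ]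
    exact if_congr (Equiv.Perm.sameCycle_apply_right (f := ρ) (y := (x, y))) rfl rfl
  have hblock : ∀ (q : Cycles σ) (r : Cycles τ),
      ∑ x with (⟦x⟧ : Cycles σ) = q, ∑ y with (⟦y⟧ : Cycles τ) = r, d x y
        = (Nat.lcm (cycleLength σ q) (cycleLength τ r) : ℝ) * c q r := by
    intro q r
    rw [← Finset.sum_product']
    have e1 : ∀ p ∈ (Finset.univ.filter fun x : ι => (⟦x⟧ : Cycles σ) = q) ×ˢ
        (Finset.univ.filter fun y : κ => (⟦y⟧ : Cycles τ) = r),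
        d p.1 p.2 = if ρ.SameCycle (q.out, r.out) p then c q r else 0 := by
      rintro ⟨x, y⟩ hp
      simp only [Finset.mem_product, Finset.mem_filter, Finset.mem_univ, true_and] at hp
      obtain ⟨rfl, rfl⟩ := hp
      rfl
    rw [Finset.sum_congr rfl e1, ← Finset.sum_filter]
    have e2 : ((Finset.univ.filter fun x : ι => (⟦x⟧ : Cycles σ) = q) ×ˢ
        (Finset.univ.filter fun y : κ => (⟦y⟧ : Cycles τ) = r)).filter
          (fun p => ρ.SameCycle (q.out, r.out) p)
        = Finset.univ.filter fun p => ρ.SameCycle (q.out, r.out) p := by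
      ext ⟨x, y⟩
      simp only [Finset.mem_filter, Finset.mem_product, Finset.mem_univ, true_and,
        and_iff_right_iff_imp]
      rintro ⟨i, hi⟩
      rw [prodCongr_zpow_apply, Prod.mk.injEq] at hi
      constructor
      · rw [← q.out_eq]
        exact Quotient.sound (Equiv.Perm.SameCycle.symm ⟨i, hi.1⟩)
      · rw [← r.out_eq]
        exact Quotient.sound (Equiv.Perm.SameCycle.symm ⟨i, hi.2⟩)
    rw [e2, Finset.sum_const, card_product_cycle, nsmul_eq_mul]
    rfl
  refine ⟨d, fun x y => ?_, hd, fun x => ?_, fun y => ?_⟩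
  · simp only [d]
    split_ifs
    exacts [hc _ _, h0]
  · have hinv : ∀ x, ∑ y, d (σ x) y = ∑ y, d x y := fun x => by
      rw [← Equiv.sum_comp τ]
      exact Finset.sum_congr rfl fun y _ => hd x y
    -- the marginal is constant on cycles, so it suffices to compare total masses of cycles
    have key : ∀ q : Cycles σ, ∑ y, d q.out y = a q.out := by
      intro q
      have hpos : (cycleLength σ q : ℝ) ≠ 0 := by
        exact_mod_cast (cycleLength_pos σ q).ne'
      apply mul_left_cancel₀ hpos
      rw [← sum_cycle_eq σ (f := fun x => ∑ y, d x y) hinv q, h2 q,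
        ← Finset.sum_congr rfl fun r _ => hblock q r]
      refine Eq.trans ?_ Finset.sum_comm
      exact Finset.sum_congr rfl fun x _ =>
        (Finset.sum_fiberwise (s := Finset.univ) (g := fun y : κ => (⟦y⟧ : Cycles τ)) _).symm
    have hx : Equiv.Perm.SameCycle σ (⟦x⟧ : Cycles σ).out x :=
      Quotient.exact (s := Equiv.Perm.SameCycle.setoid _) (Quotient.out_eq _)
    rw [← invariant_of_sameCycle hσ hx, ← key,
      invariant_of_sameCycle (f := fun x => ∑ y, d x y) hinv hx]
  · have hinv : ∀ y, ∑ x, d x (τ y) = ∑ x, d x y := fun y => by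
      rw [← Equiv.sum_comp σ]
      exact Finset.sum_congr rfl fun x _ => hd x y
    have key : ∀ r : Cycles τ, ∑ x, d x r.out = b r.out := by
      intro r
      have hpos : (cycleLength τ r : ℝ) ≠ 0 := by
        exact_mod_cast (cycleLength_pos τ r).ne'
      apply mul_left_cancel₀ hpos
      rw [← sum_cycle_eq τ (f := fun y => ∑ x, d x y) hinv r, h1 r,
        ← Finset.sum_congr rfl fun q _ => hblock q r,
        Finset.sum_comm]
      exact (Finset.sum_fiberwise (s := Finset.univ) (g := fun x : ι => (⟦x⟧ : Cycles σ)) _).symm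
    have hy : Equiv.Perm.SameCycle τ (⟦y⟧ : Cycles τ).out y :=
      Quotient.exact (s := Equiv.Perm.SameCycle.setoid _) (Quotient.out_eq _)
    rw [← invariant_of_sameCycle hτ hy, ← key,
      invariant_of_sameCycle (f := fun y => ∑ x, d x y) hinv hy]

/-! ### Group-like sets -/

lemma IsGroupLike.mem_iff {V : Set ℝ} (hV : IsGroupLike V) {x : ℝ} :
    x ∈ V ↔ x ∈ AddSubgroup.closure (V ∪ {1}) ∧ 0 ≤ x ∧ x ≤ 1 := by
  conv_lhs => rw [hV.eq_hull]
  rfl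

lemma IsGroupLike.mem_closure {V : Set ℝ} {x : ℝ} (hx : x ∈ V) :
    x ∈ AddSubgroup.closure (V ∪ {1}) :=
  AddSubgroup.subset_closure (Or.inl hx)

lemma IsGroupLike.zero_mem {V : Set ℝ} (hV : IsGroupLike V) : (0 : ℝ) ∈ V :=
  hV.mem_iff.2 ⟨AddSubgroup.zero_mem _, le_rfl, zero_le_one⟩

lemma IsGroupLike.mem_iff_addInt {V : Set ℝ} (hV : IsGroupLike V) {x : ℝ} :
    x ∈ V ↔ x ∈ addInt V ∧ 0 ≤ x ∧ x ≤ 1 := by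
  constructor
  · intro hx
    exact ⟨⟨x, hx, 0, ⟨0, by simp⟩, by simp⟩, (hV.mem_iff.1 hx).2⟩
  · rintro ⟨⟨y, hy, _, ⟨k, rfl⟩, rfl⟩, h⟩
    refine hV.mem_iff.2 ⟨AddSubgroup.add_mem _ (IsGroupLike.mem_closure hy) ?_, h⟩
    have := AddSubgroup.zsmul_mem _
      (AddSubgroup.subset_closure (Or.inr rfl) : (1 : ℝ) ∈ AddSubgroup.closure (V ∪ {1})) k
    simpa using this

/-! ### From joinings to the lcm condition -/

lemma minimalPeriod_finRotate (n : ℕ) (i : Fin n) : Function.minimalPeriod (finRotate n) i = n := by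
  classical
  rw [← card_sameCycle_eq_minimalPeriod, Finset.filter_true_of_mem, Finset.card_univ,
    Fintype.card_fin]
  intro j _
  rcases n with _ | _ | n
  · exact i.elim0
  · have := Fin.subsingleton_one
    rw [show j = i from Subsingleton.elim (α := Fin 1) j i]
  · exact isCycle_finRotate.sameCycle (by simp [finRotate_apply]) (by simp [finRotate_apply])

theorem HasInvariantJoinings.lcmCondition {V : Set ℝ} (hV : IsGroupLike V)
    (h : HasInvariantJoinings.{0, 0} V) : LcmCondition V := by
  intro p q a b n m ha hb hna hmb
  obtain ⟨c, hc, hinv, h1, h2⟩ := h (Σ i : Fin p, Fin (n i)) (Σ j : Fin q, Fin (m j))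
    (Equiv.sigmaCongrRight fun i => finRotate (n i))
    (Equiv.sigmaCongrRight fun j => finRotate (m j))
    (fun x => a x.1) (fun y => b y.1) (fun _ => ha _) (fun _ => hb _) (fun _ => rfl)
    (fun _ => rfl) (by rw [Fintype.sum_sigma]; simpa using hna)
    (by rw [Fintype.sum_sigma]; simpa using hmb)
  let ρ : ∀ (i : Fin p) (j : Fin q), Equiv.Perm (Fin (n i) × Fin (m j)) := fun i j =>
    (finRotate (n i)).prodCongr (finRotate (m j))
  let w : ∀ (i : Fin p) (j : Fin q), Fin (n i) × Fin (m j) → ℝ := fun i j z =>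
    c ⟨i, z.1⟩ ⟨j, z.2⟩
  have hw : ∀ i j z, w i j (ρ i j z) = w i j z := fun i j z => hinv ⟨i, z.1⟩ ⟨j, z.2⟩
  -- all cycles in the product of a cycle of length `n i` and one of length `m j` have length
  -- `lcm (n i) (m j)`
  have hsum : ∀ i j, ∑ r, ∑ s, c ⟨i, r⟩ ⟨j, s⟩
      = (Nat.lcm (n i) (m j) : ℝ) * ∑ z : Cycles (ρ i j), w i j z.out := by
    intro i j
    rw [← Fintype.sum_prod_type', Finset.mul_sum]
    refine (sum_eq_sum_cycles (ρ i j) (hw i j)).trans (Finset.sum_congr rfl fun z _ => ?_)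
    congr 2
    refine (Function.minimalPeriod_prodMap (finRotate (n i)) (finRotate (m j)) _).trans ?_
    rw [minimalPeriod_finRotate, minimalPeriod_finRotate]
  have hrow : ∀ i, (n i : ℝ) * a i = ∑ j, ∑ r, ∑ s, c ⟨i, r⟩ ⟨j, s⟩ := by
    intro i
    rw [Finset.sum_comm]
    have : ∀ r : Fin (n i), ∑ j, ∑ s, c ⟨i, r⟩ ⟨j, s⟩ = a i := fun r => by
      rw [← h1 ⟨i, r⟩, Fintype.sum_sigma]
    simp [this]
  have hcol : ∀ j, (m j : ℝ) * b j = ∑ i, ∑ r, ∑ s, c ⟨i, r⟩ ⟨j, s⟩ := by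
    intro j
    rw [Finset.sum_congr rfl fun i _ => Finset.sum_comm, Finset.sum_comm]
    have : ∀ s : Fin (m j), ∑ i, ∑ r, c ⟨i, r⟩ ⟨j, s⟩ = b j := fun s => by
      rw [← h2 ⟨j, s⟩, Fintype.sum_sigma]
    simp [this]
  have hc0 : ∀ x y, 0 ≤ c x y := fun x y => (hV.subset_Icc (hc x y)).1
  refine ⟨fun i j => ∑ z : Cycles (ρ i j), w i j z.out, fun i j => ?_, fun j => ?_, fun i => ?_⟩
  · refine hV.mem_iff.2 ⟨AddSubgroup.sum_mem _ fun z _ => IsGroupLike.mem_closure (hc _ _),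
      Finset.sum_nonneg fun z _ => hc0 _ _, ?_⟩
    rcases Nat.eq_zero_or_pos (Nat.lcm (n i) (m j)) with h0 | hpos
    · have : IsEmpty (Cycles (ρ i j)) := by
        refine ⟨fun z => ?_⟩
        rcases Nat.lcm_eq_zero_iff.1 h0 with h0 | h0
        · exact (h0 ▸ z.out.1 : Fin 0).elim0
        · exact (h0 ▸ z.out.2 : Fin 0).elim0
      simp
    · have hnn : 0 ≤ ∑ z : Cycles (ρ i j), w i j z.out := Finset.sum_nonneg fun z _ => hc0 _ _
      have hle : (Nat.lcm (n i) (m j) : ℝ) * ∑ z : Cycles (ρ i j), w i j z.out ≤ 1 := by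
        rw [← hsum, ← hna]
        refine le_trans ?_ (Finset.single_le_sum (f := fun i => (n i : ℝ) * a i)
          (fun i _ => mul_nonneg (Nat.cast_nonneg _) (hV.subset_Icc (ha i)).1)
          (Finset.mem_univ i))
        simp only [hrow i]
        exact Finset.single_le_sum (f := fun j => ∑ r, ∑ s, c ⟨i, r⟩ ⟨j, s⟩)
          (fun j _ => Finset.sum_nonneg fun r _ => Finset.sum_nonneg fun s _ => hc0 _ _)
          (Finset.mem_univ j)
      have : (1 : ℝ) ≤ (Nat.lcm (n i) (m j) : ℝ) := by exact_mod_cast hpos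
      nlinarith
  · rw [hcol j]
    exact Finset.sum_congr rfl fun i _ => hsum i j
  · rw [hrow i]
    exact Finset.sum_congr rfl fun j _ => hsum i j

/-! ### Two sufficient conditions for the lcm condition -/

/-- Given two families of nonnegative reals with the same sum, lay them out as consecutive
intervals. The lengths of the overlaps of these intervals form a matrix with the given row and
column sums. These lengths lie in any additive group that contains both families. -/
lemma exists_common_refinement (G : AddSubgroup ℝ) {p q : ℕ} (α : Fin p → ℝ) (β : Fin q → ℝ)
    (hα : ∀ i, α i ∈ G) (hβ : ∀ j, β j ∈ G) (hα0 : ∀ i, 0 ≤ α i) (hβ0 : ∀ j, 0 ≤ β j)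
    (hsum : ∑ i, α i = ∑ j, β j) :
    ∃ d : Fin p → Fin q → ℝ, (∀ i j, d i j ∈ G) ∧ (∀ i j, 0 ≤ d i j) ∧
      (∀ i, ∑ j, d i j = α i) ∧ (∀ j, ∑ i, d i j = β j) := by
  let α' : ℕ → ℝ := fun k => if h : k < p then α ⟨k, h⟩ else 0
  let β' : ℕ → ℝ := fun k => if h : k < q then β ⟨k, h⟩ else 0
  let A : ℕ → ℝ := fun k => ∑ l ∈ Finset.range k, α' l
  let B : ℕ → ℝ := fun k => ∑ l ∈ Finset.range k, β' l
  have hα' : ∀ k, α' k ∈ G ∧ 0 ≤ α' k := fun k => by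
    by_cases h : k < p
    · simp only [α', h, dite_true]; exact ⟨hα _, hα0 _⟩
    · simp only [α', h, dite_false]; exact ⟨G.zero_mem, le_rfl⟩
  have hβ' : ∀ k, β' k ∈ G ∧ 0 ≤ β' k := fun k => by
    by_cases h : k < q
    · simp only [β', h, dite_true]; exact ⟨hβ _, hβ0 _⟩
    · simp only [β', h, dite_false]; exact ⟨G.zero_mem, le_rfl⟩
  have hAG : ∀ k, A k ∈ G := fun k => G.sum_mem fun l _ => (hα' l).1
  have hBG : ∀ k, B k ∈ G := fun k => G.sum_mem fun l _ => (hβ' l).1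
  have hA0 : ∀ k, 0 ≤ A k := fun k => Finset.sum_nonneg fun l _ => (hα' l).2
  have hB0 : ∀ k, 0 ≤ B k := fun k => Finset.sum_nonneg fun l _ => (hβ' l).2
  have hAs : ∀ k, A k ≤ A (k + 1) := fun k => by
    simp only [A, Finset.sum_range_succ]; linarith [(hα' k).2]
  have hBs : ∀ k, B k ≤ B (k + 1) := fun k => by
    simp only [B, Finset.sum_range_succ]; linarith [(hβ' k).2]
  have hAB : A p = B q := by
    have h1 : A p = ∑ i, α i := by
      simp only [A, Finset.sum_range]
      exact Finset.sum_congr rfl fun i _ => by simp [α']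
    have h2 : B q = ∑ j, β j := by
      simp only [B, Finset.sum_range]
      exact Finset.sum_congr rfl fun i _ => by simp [β']
    rw [h1, h2, hsum]
  have hmin : ∀ k l, min (A k) (B l) ∈ G := fun k l => by
    rcases min_choice (A k) (B l) with h | h <;> rw [h]
    exacts [hAG k, hBG l]
  refine ⟨fun i j => (min (A (i + 1)) (B (j + 1)) - min (A i) (B (j + 1)))
    - (min (A (i + 1)) (B j) - min (A i) (B j)), fun i j => ?_, fun i j => ?_, fun i => ?_,
    fun j => ?_⟩
  · exact G.sub_mem (G.sub_mem (hmin _ _) (hmin _ _)) (G.sub_mem (hmin _ _) (hmin _ _))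
  · have h1 := hAs i
    have h2 := hBs j
    rcases min_cases (A (i + 1)) (B (j + 1)) with h | h <;>
    rcases min_cases (A i) (B (j + 1)) with h' | h' <;>
    rcases min_cases (A (i + 1)) (B j) with h'' | h'' <;>
    rcases min_cases (A i) (B j) with h3 | h3 <;> linarith
  · rw [← Finset.sum_range fun j : ℕ => (min (A (i + 1)) (B (j + 1)) - min (A i) (B (j + 1)))
      - (min (A (i + 1)) (B j) - min (A i) (B j)),
      Finset.sum_range_sub fun j => min (A (i + 1)) (B j) - min (A i) (B j), ← hAB]
    have hmono : Monotone A := monotone_nat_of_le_succ hAs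
    rw [min_eq_left (hmono i.2), min_eq_left (hmono i.2.le)]
    have hB00 : B 0 = 0 := by simp [B]
    rw [hB00, min_eq_right (hA0 _), min_eq_right (hA0 _)]
    simp only [A, Finset.sum_range_succ]
    simp [α']
  · rw [← Finset.sum_range fun i : ℕ => (min (A (i + 1)) (B (j + 1)) - min (A i) (B (j + 1)))
      - (min (A (i + 1)) (B j) - min (A i) (B j)), Finset.sum_sub_distrib,
      Finset.sum_range_sub fun i => min (A i) (B (j + 1)),
      Finset.sum_range_sub fun i => min (A i) (B j), hAB]
    have hmono : Monotone B := monotone_nat_of_le_succ hBs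
    rw [min_eq_right (hmono j.2), min_eq_right (hmono j.2.le)]
    have hA00 : A 0 = 0 := by simp [A]
    rw [hA00, min_eq_left (hB0 _), min_eq_left (hB0 _)]
    simp only [B, Finset.sum_range_succ]
    simp [β']

lemma le_one_of_sum_eq_one {p : ℕ} {f : Fin p → ℝ} (h0 : ∀ i, 0 ≤ f i) (h1 : ∑ i, f i = 1)
    (i : Fin p) : f i ≤ 1 :=
  h1 ▸ Finset.single_le_sum (f := f) (fun i _ => h0 i) (Finset.mem_univ i)

theorem LcmCondition.of_rat_submodule {V : Set ℝ} (hV : IsGroupLike V) (W : Submodule ℚ ℝ)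
    (hW : (W : Set ℝ) = addInt V) : LcmCondition V := by
  intro p q a b n m ha hb hna hmb
  have hVW : ∀ {x}, x ∈ V ↔ x ∈ W ∧ 0 ≤ x ∧ x ≤ 1 := fun {x} => by
    rw [hV.mem_iff_addInt, ← hW]; rfl
  have hα0 : ∀ i, 0 ≤ (n i : ℝ) * a i := fun i =>
    mul_nonneg (Nat.cast_nonneg _) (hVW.1 (ha i)).2.1
  have hβ0 : ∀ j, 0 ≤ (m j : ℝ) * b j := fun j =>
    mul_nonneg (Nat.cast_nonneg _) (hVW.1 (hb j)).2.1
  have hmul : ∀ (k : ℕ) {x}, x ∈ W → (k : ℝ) * x ∈ W := fun k x hx => by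
    rw [← nsmul_eq_mul]; exact W.nsmul_mem hx k
  obtain ⟨d, hdW, hd0, hrow, hcol⟩ := exists_common_refinement W.toAddSubgroup
    (fun i => (n i : ℝ) * a i) (fun j => (m j : ℝ) * b j)
    (fun i => hmul _ (hVW.1 (ha i)).1) (fun j => hmul _ (hVW.1 (hb j)).1)
    hα0 hβ0 (hna.trans hmb.symm)
  have hle_row : ∀ i j, d i j ≤ (n i : ℝ) * a i := fun i j => by
    rw [← hrow i]
    exact Finset.single_le_sum (f := fun j => d i j) (fun j _ => hd0 i j) (Finset.mem_univ j)
  have hle_col : ∀ i j, d i j ≤ (m j : ℝ) * b j := fun i j => by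
    rw [← hcol j]
    exact Finset.single_le_sum (f := fun i => d i j) (fun i _ => hd0 i j) (Finset.mem_univ i)
  -- when the lcm vanishes, so does `d i j`
  have hcancel : ∀ i j,
      (Nat.lcm (n i) (m j) : ℝ) * (d i j / (Nat.lcm (n i) (m j) : ℝ)) = d i j := by
    intro i j
    rcases eq_or_ne (Nat.lcm (n i) (m j)) 0 with h0 | hne
    · have : d i j = 0 := by
        refine le_antisymm ?_ (hd0 i j)
        rcases Nat.lcm_eq_zero_iff.1 h0 with h0 | h0
        · simpa [h0] using hle_row i j
        · simpa [h0] using hle_col i j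
      simp [this]
    · exact mul_div_cancel₀ _ (by exact_mod_cast hne)
  refine ⟨fun i j => d i j / (Nat.lcm (n i) (m j) : ℝ), fun i j => hVW.2 ⟨?_, ?_, ?_⟩,
    fun j => ?_, fun i => ?_⟩
  · have := W.smul_mem ((Nat.lcm (n i) (m j) : ℚ)⁻¹) (hdW i j)
    rw [Rat.smul_def] at this
    push_cast at this
    beta_reduce
    rwa [div_eq_inv_mul]
  · exact div_nonneg (hd0 i j) (Nat.cast_nonneg _)
  · have hd1 : d i j ≤ 1 := (hle_row i j).trans (le_one_of_sum_eq_one hα0 hna i)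
    rcases Nat.eq_zero_or_pos (Nat.lcm (n i) (m j)) with h0 | hpos
    · simp [h0]
    · exact (div_le_self (hd0 i j) (by exact_mod_cast hpos)).trans hd1
  · rw [← hcol j]
    exact Finset.sum_congr rfl fun i _ => (hcancel i j).symm
  · rw [← hrow i]
    exact Finset.sum_congr rfl fun j _ => (hcancel i j).symm

theorem LcmCondition.of_subring {V : Set ℝ} (hV : IsGroupLike V) (R : Subring ℝ)
    (hR : (R : Set ℝ) = addInt V) : LcmCondition V := by
  intro p q a b n m ha hb hna hmb
  have hVR : ∀ {x}, x ∈ V ↔ x ∈ R ∧ 0 ≤ x ∧ x ≤ 1 := fun {x} => by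
    rw [hV.mem_iff_addInt, ← hR]; rfl
  have ha' := fun i => hVR.1 (ha i)
  have hb' := fun j => hVR.1 (hb j)
  have hgl : ∀ i j, (Nat.lcm (n i) (m j) : ℝ) * ((Nat.gcd (n i) (m j) : ℝ) * a i * b j)
      = (n i * a i) * (m j * b j) := fun i j => by
    have : (Nat.gcd (n i) (m j) : ℝ) * (Nat.lcm (n i) (m j) : ℝ) = n i * m j := by
      exact_mod_cast Nat.gcd_mul_lcm (n i) (m j)
    linear_combination (a i * b j) * this
  have hα0 : ∀ i, 0 ≤ (n i : ℝ) * a i := fun i => mul_nonneg (Nat.cast_nonneg _) (ha' i).2.1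
  have hβ0 : ∀ j, 0 ≤ (m j : ℝ) * b j := fun j => mul_nonneg (Nat.cast_nonneg _) (hb' j).2.1
  refine ⟨fun i j => (Nat.gcd (n i) (m j) : ℝ) * a i * b j, fun i j => hVR.2 ⟨?_, ?_, ?_⟩,
    fun j => ?_, fun i => ?_⟩
  · exact R.mul_mem (R.mul_mem (natCast_mem R _) (ha' i).1) (hb' j).1
  · exact mul_nonneg (mul_nonneg (Nat.cast_nonneg _) (ha' i).2.1) (hb' j).2.1
  · rcases Nat.eq_zero_or_pos (n i) with h0 | hpos
    · beta_reduce
      rw [h0, Nat.gcd_zero_left, mul_right_comm]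
      exact mul_le_one₀ (le_one_of_sum_eq_one hβ0 hmb j) (ha' i).2.1 (ha' i).2.2
    · refine mul_le_one₀ (le_trans ?_ (le_one_of_sum_eq_one hα0 hna i)) (hb' j).2.1 (hb' j).2.2
      exact mul_le_mul_of_nonneg_right (by exact_mod_cast Nat.gcd_le_left _ hpos) (ha' i).2.1
  · rw [Finset.sum_congr rfl fun i _ => hgl i j, ← Finset.sum_mul, hna, one_mul]
  · rw [Finset.sum_congr rfl fun j _ => hgl i j, ← Finset.mul_sum, hmb, mul_one]

/-! ### Circulations are sums of cycles -/

lemma nonempty_periodicPts {S : Type*} [Finite S] [Nonempty S] (f : S → S) :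
    (Function.periodicPts f).Nonempty := by
  obtain ⟨x⟩ := ‹Nonempty S›
  have key : ∀ k l : ℕ, k < l → f^[k] x = f^[l] x → (Function.periodicPts f).Nonempty := by
    intro k l hkl h
    refine ⟨f^[k] x, l - k, Nat.sub_pos_of_lt hkl, ?_⟩
    change f^[l - k] (f^[k] x) = f^[k] x
    rw [← Function.iterate_add_apply, Nat.sub_add_cancel hkl.le, h]
  obtain ⟨k, l, hne, h⟩ := Finite.exists_ne_map_eq_of_infinite fun k : ℕ => f^[k] x
  rcases lt_or_gt_of_ne hne with hlt | hlt
  · exact key k l hlt h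
  · exact key l k hlt h.symm

/-- A circulation `w` on a finite set `S`, with values in a group `G` of reals, is carried by a
permutation with positive invariant weights in `G`.

If `w ≠ 0`, choose for every vertex with an outgoing flow one edge along which it is positive.
This defines a self-map, which permutes its nonempty set of periodic points. Subtracting the
minimal flow along the edges of this permutation leaves a circulation with fewer edges. -/
theorem exists_weighted_perm_of_circulation.{u} (G : AddSubgroup ℝ) {S : Type u} [Fintype S]
    [DecidableEq S] (w : S → S → ℝ) (hG : ∀ s t, w s t ∈ G) (h0 : ∀ s t, 0 ≤ w s t)
    (hw : ∀ s, ∑ t, w s t = ∑ t, w t s) :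
    ∃ (ι : Type u) (_ : Fintype ι) (σ : Equiv.Perm ι) (π : ι → S) (a : ι → ℝ),
      (∀ x, a x ∈ G) ∧ (∀ x, 0 < a x) ∧ (∀ x, a (σ x) = a x) ∧
      ∀ s t, w s t = ∑ x, if π x = s ∧ π (σ x) = t then a x else 0 := by
  classical
  induction hN : (Finset.univ.filter fun e : S × S => w e.1 e.2 ≠ 0).card using
    Nat.strong_induction_on generalizing w with
  | _ N ih =>
  by_cases hzero : ∀ s t, w s t = 0
  · exact ⟨PEmpty, inferInstance, 1, PEmpty.elim, PEmpty.elim, fun x => x.elim, fun x => x.elim,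
      fun x => x.elim, by simp [hzero]⟩
  push Not at hzero
  -- a vertex reached by a positive flow has a positive outgoing flow, by balance
  have hnext : ∀ s : {s // ∃ t, w s t ≠ 0}, ∃ t : {s // ∃ t, w s t ≠ 0}, w s t ≠ 0 := by
    rintro ⟨s, t, hst⟩
    refine ⟨⟨t, ?_⟩, hst⟩
    by_contra! hcon
    have h1 := hw t
    rw [Finset.sum_eq_zero fun u _ => hcon u] at h1
    exact hst ((Finset.sum_eq_zero_iff_of_nonneg fun u _ => h0 u t).1 h1.symm s
      (Finset.mem_univ _))
  choose f hf using hnext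
  have : Nonempty {s // ∃ t, w s t ≠ 0} := let ⟨s, t, h⟩ := hzero; ⟨⟨s, t, h⟩⟩
  let T := Function.periodicPts f
  have : Nonempty T := (nonempty_periodicPts f).to_subtype
  let ρ : Equiv.Perm T := (Function.bijOn_periodicPts f).equiv f
  let v : T → S := fun x => x.1.1
  have hv : Function.Injective v := Subtype.val_injective.comp Subtype.val_injective
  have hρ : ∀ x : T, w (v x) (v (ρ x)) ≠ 0 := fun x => hf x.1
  obtain ⟨x₀, hx₀⟩ := Finite.exists_min fun x : T => w (v x) (v (ρ x))
  set δ := w (v x₀) (v (ρ x₀)) with hδ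
  have hδ0 : 0 < δ := lt_of_le_of_ne (h0 _ _) (hρ x₀).symm
  let u : S → S → ℝ := fun s t => ∑ x : T, if v x = s ∧ v (ρ x) = t then δ else 0
  have hu_edge : ∀ x, u (v x) (v (ρ x)) = δ := fun x => by
    simp only [u]
    rw [Finset.sum_eq_single x]
    · simp
    · intro y _ hy
      rw [if_neg fun h => hy (hv h.1)]
    · simp
  have hu_other : ∀ s t, (¬ ∃ x, v x = s ∧ v (ρ x) = t) → u s t = 0 := fun s t h =>
    Finset.sum_eq_zero fun x _ => if_neg fun hx => h ⟨x, hx⟩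
  have hu_le : ∀ s t, u s t ≤ w s t := fun s t => by
    by_cases h : ∃ x, v x = s ∧ v (ρ x) = t
    · obtain ⟨x, rfl, rfl⟩ := h
      rw [hu_edge]
      exact hx₀ x
    · rw [hu_other s t h]
      exact h0 s t
  have hu_bal : ∀ s, ∑ t, u s t = ∑ t, u t s := fun s => by
    have e1 : ∑ t, u s t = ∑ x : T, if v x = s then δ else 0 := by
      simp only [u]
      rw [Finset.sum_comm]
      refine Finset.sum_congr rfl fun x _ => ?_
      by_cases h : v x = s <;> simp [h]
    have e2 : ∑ t, u t s = ∑ x : T, if v (ρ x) = s then δ else 0 := by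
      simp only [u]
      rw [Finset.sum_comm]
      refine Finset.sum_congr rfl fun x _ => ?_
      by_cases h : v (ρ x) = s <;> simp [h]
    rw [e1, e2]
    exact (Equiv.sum_comp ρ fun x => if v x = s then δ else 0).symm
  have hδG : δ ∈ G := hG _ _
  have hcard : (Finset.univ.filter fun e : S × S => w e.1 e.2 - u e.1 e.2 ≠ 0).card < N := by
    rw [← hN]
    refine Finset.card_lt_card (Finset.ssubset_iff_of_subset ?_ |>.2
      ⟨(v x₀, v (ρ x₀)), by simpa using hρ x₀, by simp [hu_edge, hδ]⟩)
    intro e he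
    simp only [Finset.mem_filter, Finset.mem_univ, true_and] at he ⊢
    intro h
    have h1 := hu_le e.1 e.2
    have h2 : 0 ≤ u e.1 e.2 := Finset.sum_nonneg fun x _ => by split_ifs <;> [exact hδ0.le; rfl]
    exact he (by linarith)
  obtain ⟨ι, _, σ, π, a, haG, ha0, hσ, hsum⟩ := ih _ hcard (fun s t => w s t - u s t)
    (fun s t => G.sub_mem (hG s t) (G.sum_mem fun x _ => by
      split_ifs
      exacts [hδG, G.zero_mem]))
    (fun s t => sub_nonneg.2 (hu_le s t))
    (fun s => by simp only [Finset.sum_sub_distrib, hw s, hu_bal s]) rfl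
  refine ⟨ι ⊕ T, inferInstance, Equiv.sumCongr σ ρ, Sum.elim π v, Sum.elim a fun _ => δ,
    ?_, ?_, ?_, ?_⟩
  · rintro (x | x)
    exacts [haG x, hδG]
  · rintro (x | x)
    exacts [ha0 x, hδ0]
  · rintro (x | x)
    exacts [hσ x, rfl]
  · intro s t
    rw [Fintype.sum_sum_type]
    have := hsum s t
    simp only [Sum.elim_inl, Sum.elim_inr, Equiv.sumCongr_apply, Sum.map_inl, Sum.map_inr]
    rw [← this]
    simp only [u]
    ring

/-! ### Clopen partitions and good measures -/

/-- An indexed partition of a space into clopen sets. The pieces are allowed to be empty. -/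
structure IsClopenPartition {X ι : Type*} [TopologicalSpace X] (C : ι → Clopens X) : Prop where
  disjoint : ∀ i j, i ≠ j → Disjoint (C i) (C j)
  exhaustive : ∀ x : X, ∃ i, x ∈ C i

lemma Clopens.disjoint_iff_forall {X : Type*} [TopologicalSpace X] {A B : Clopens X} :
    Disjoint A B ↔ ∀ x ∈ A, x ∉ B := by
  rw [← Clopens.coe_disjoint, Set.disjoint_left]
  rfl

namespace IsClopenPartition

variable {X ι : Type*} [TopologicalSpace X] {C : ι → Clopens X}

lemma eq_of_mem (hC : IsClopenPartition C) {i j : ι} {x : X} (hi : x ∈ C i) (hj : x ∈ C j) :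
    i = j := by
  by_contra h
  exact Clopens.disjoint_iff_forall.1 (hC.disjoint i j h) x hi hj

lemma comp_perm (hC : IsClopenPartition C) (ρ : Equiv.Perm ι) : IsClopenPartition (C ∘ ρ) where
  disjoint i j hij := hC.disjoint _ _ (ρ.injective.ne hij)
  exhaustive x := by
    obtain ⟨i, hi⟩ := hC.exhaustive x
    exact ⟨ρ.symm i, by simpa using hi⟩

lemma image (hC : IsClopenPartition C) (h : X ≃ₜ X) {D : ι → Clopens X}
    (hD : ∀ i, h '' C i = D i) : IsClopenPartition D where
  disjoint i j hij := by
    rw [← Clopens.coe_disjoint, ← hD, ← hD, Set.disjoint_image_iff h.injective,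
      Clopens.coe_disjoint]
    exact hC.disjoint i j hij
  exhaustive x := by
    obtain ⟨i, hi⟩ := hC.exhaustive (h.symm x)
    refine ⟨i, ?_⟩
    change x ∈ (D i : Set X)
    rw [← hD i]
    exact ⟨_, hi, h.apply_symm_apply x⟩

lemma sum_measureReal_inter [MeasurableSpace X] [BorelSpace X] [Fintype ι]
    (hC : IsClopenPartition C) (μ : Measure X) [IsFiniteMeasure μ] {A : Set X}
    (hA : MeasurableSet A) : ∑ i, μ.real (A ∩ C i) = μ.real A := by
  have h1 : A = ⋃ i ∈ Finset.univ, A ∩ C i := by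
    ext x
    simp only [Finset.mem_univ, iUnion_true, mem_iUnion, mem_inter_iff]
    refine ⟨fun hx => ?_, fun ⟨i, hi⟩ => hi.1⟩
    obtain ⟨i, hi⟩ := hC.exhaustive x
    exact ⟨i, hx, hi⟩
  conv_rhs => rw [h1]
  rw [measureReal_biUnion_finset]
  · intro i _ j _ hij
    exact ((Clopens.coe_disjoint.2 (hC.disjoint i j hij)).inter_left' A).inter_right' A
  · exact fun i _ => hA.inter (C i).isOpen.measurableSet

lemma sum_measureReal [MeasurableSpace X] [BorelSpace X] [Fintype ι]
    (hC : IsClopenPartition C) (μ : Measure X) [IsProbabilityMeasure μ] :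
    ∑ i, μ.real (C i) = 1 := by
  have := hC.sum_measureReal_inter μ MeasurableSet.univ
  simpa using this

end IsClopenPartition

lemma measureReal_mem_of_isClopen {X : Type*} [TopologicalSpace X] [MeasurableSpace X]
    {μ : Measure X} {V : Set ℝ} (hV : clopenValueSet μ = V) {A : Set X} (hA : IsClopen A) :
    μ.real A ∈ V :=
  hV ▸ ⟨A, hA, rfl⟩

namespace IsGoodMeasure

variable {X : Type*} [TopologicalSpace X] [MeasurableSpace X] {μ : Measure X}

lemma measureReal_eq_iff (hμ : IsGoodMeasure μ) {A B : Set X} :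
    μ.real A = μ.real B ↔ μ A = μ B := by
  have := hμ.isProbability
  exact measureReal_eq_measureReal_iff

/-- A value of the measure on clopen sets is attained inside every larger clopen set. -/
lemma exists_clopen_le (hμ : IsGoodMeasure μ) {r : ℝ} (hr : r ∈ clopenValueSet μ)
    (B : Clopens X) (h : r ≤ μ.real B) : ∃ C : Clopens X, C ≤ B ∧ μ.real C = r := by
  have := hμ.isProbability
  obtain ⟨A, hA, rfl⟩ := hr
  obtain ⟨C, hC, hCB, hCA⟩ := hμ.subset_condition A B hA B.isClopen
    ((ENNReal.toReal_le_toReal (measure_ne_top _ _) (measure_ne_top _ _)).1 h)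
  exact ⟨⟨C, hC⟩, hCB, hμ.measureReal_eq_iff.2 hCA⟩

lemma eq_bot_of_measureReal_eq_zero (hμ : IsGoodMeasure μ) {A : Clopens X}
    (h : μ.real A = 0) : A = ⊥ := by
  have := hμ.isProbability
  by_contra hne
  refine hμ.fullSupport A A.isOpen ?_ ((measureReal_eq_zero_iff (measure_ne_top _ _)).1 h)
  rw [Set.nonempty_iff_ne_empty]
  exact fun h0 => hne (Clopens.ext h0)

/-- A clopen set can be cut into pieces of prescribed measures, taken off one after the other by the
subset condition. -/
lemma exists_split_finset [BorelSpace X] (hμ : IsGoodMeasure μ) {K : Type*} [DecidableEq K]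
    (s : Finset K) (c : K → ℝ) (hc : ∀ k ∈ s, c k ∈ clopenValueSet μ) (A : Clopens X)
    (hA : ∑ k ∈ s, c k = μ.real A) :
    ∃ E : K → Clopens X, (∀ k ∈ s, E k ≤ A) ∧ (∀ k ∈ s, ∀ l ∈ s, k ≠ l → Disjoint (E k) (E l)) ∧
      (∀ x ∈ A, ∃ k ∈ s, x ∈ E k) ∧ ∀ k ∈ s, μ.real (E k) = c k := by
  have := hμ.isProbability
  induction s using Finset.induction_on generalizing A with
  | empty =>
    rw [Finset.sum_empty] at hA
    have := hμ.eq_bot_of_measureReal_eq_zero hA.symm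
    subst this
    exact ⟨fun _ => ⊥, by simp, by simp, fun x hx => hx.elim, by simp⟩
  | insert k s hk ih =>
    rw [Finset.sum_insert hk] at hA
    have hpos : ∀ l ∈ s, 0 ≤ c l := fun l hl => by
      obtain ⟨B, -, hB⟩ := hc l (Finset.mem_insert_of_mem hl)
      rw [← hB]
      exact measureReal_nonneg
    obtain ⟨F, hFA, hF⟩ := hμ.exists_clopen_le (hc k (Finset.mem_insert_self _ _)) A
      (by linarith [Finset.sum_nonneg hpos])
    have hdiff : μ.real ((A \ F : Clopens X) : Set X) = μ.real A - μ.real F :=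
      measureReal_sdiff hFA F.isOpen.measurableSet
    obtain ⟨E, hEA, hEd, hEe, hEc⟩ := ih (fun l hl => hc l (Finset.mem_insert_of_mem hl)) (A \ F)
      (by rw [hdiff]; linarith)
    have hne : ∀ l ∈ s, l ≠ k := fun l hl h => hk (h ▸ hl)
    refine ⟨Function.update E k F, fun l hl => ?_, fun l hl l' hl' hll => ?_, fun x hx => ?_,
      fun l hl => ?_⟩
    · rcases Finset.mem_insert.1 hl with rfl | hl
      · simpa using hFA
      · rw [Function.update_of_ne (hne l hl)]
        exact (hEA l hl).trans sdiff_le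
    · rcases Finset.mem_insert.1 hl with h | h <;>
      rcases Finset.mem_insert.1 hl' with h' | h'
      · exact absurd (h.trans h'.symm) hll
      · rw [h, Function.update_self, Function.update_of_ne (hne l' h')]
        exact disjoint_sdiff_self_right.mono_right (hEA l' h')
      · rw [h', Function.update_self, Function.update_of_ne (hne l h)]
        exact disjoint_sdiff_self_left.mono_left (hEA l h)
      · rw [Function.update_of_ne (hne l h), Function.update_of_ne (hne l' h')]
        exact hEd l h l' h' hll
    · by_cases hxF : x ∈ F
      · exact ⟨k, Finset.mem_insert_self _ _, by simpa using hxF⟩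
      · obtain ⟨l, hl, hxl⟩ := hEe x ⟨hx, hxF⟩
        refine ⟨l, Finset.mem_insert_of_mem hl, ?_⟩
        rwa [Function.update_of_ne (hne l hl)]
    · rcases Finset.mem_insert.1 hl with rfl | hl
      · simpa using hF
      · rw [Function.update_of_ne (hne l hl)]
        exact hEc l hl

/-- A clopen partition can be refined so as to realise any prescribed splitting of the measures of
its pieces into values of the measure. -/
theorem exists_refinement [BorelSpace X] (hμ : IsGoodMeasure μ) {ι K : Type*} [Fintype K]
    [DecidableEq ι] {C : ι → Clopens X} (hC : IsClopenPartition C) (π : K → ι) (c : K → ℝ)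
    (hc : ∀ k, c k ∈ clopenValueSet μ)
    (hsum : ∀ i, ∑ k with π k = i, c k = μ.real (C i)) :
    ∃ E : K → Clopens X, IsClopenPartition E ∧ (∀ k, E k ≤ C (π k)) ∧
      ∀ k, μ.real (E k) = c k := by
  classical
  choose E hEC hEd hEe hEc using fun i =>
    hμ.exists_split_finset (Finset.univ.filter fun k => π k = i) c (fun k _ => hc k) (C i) (hsum i)
  have hmem : ∀ k, k ∈ Finset.univ.filter fun l => π l = π k := fun k => by simp
  refine ⟨fun k => E (π k) k, ⟨fun k l hkl => ?_, fun x => ?_⟩, fun k => hEC _ k (hmem k),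
    fun k => hEc _ k (hmem k)⟩
  · by_cases h : π k = π l
    · have hk : k ∈ Finset.univ.filter fun l' => π l' = π l := by simp [h]
      rw [h]
      exact hEd _ k hk l (hmem l) hkl
    · exact (hC.disjoint _ _ h).mono (hEC _ k (hmem k)) (hEC _ l (hmem l))
  · obtain ⟨i, hi⟩ := hC.exhaustive x
    obtain ⟨k, hk, hxk⟩ := hEe i x hi
    refine ⟨k, ?_⟩
    rw [(Finset.mem_filter.1 hk).2]
    exact hxk

/-- Clopen partitions with prescribed measures exist. -/
lemma exists_partition [BorelSpace X] (hμ : IsGoodMeasure μ) {K : Type*} [Fintype K] (c : K → ℝ)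
    (hc : ∀ k, c k ∈ clopenValueSet μ) (hsum : ∑ k, c k = 1) :
    ∃ E : K → Clopens X, IsClopenPartition E ∧ ∀ k, μ.real (E k) = c k := by
  have := hμ.isProbability
  obtain ⟨E, hE, -, hEc⟩ := hμ.exists_refinement (ι := Unit) (C := fun _ => (⊤ : Clopens X))
    ⟨fun i j h => (h rfl).elim, fun x => ⟨(), Set.mem_univ x⟩⟩ (fun _ => ()) c hc
    (fun _ => by simpa using hsum)
  exact ⟨E, hE, hEc⟩

end IsGoodMeasure

lemma measureReal_image_eq {X : Type*} [TopologicalSpace X] [MeasurableSpace X] [BorelSpace X]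
    {μ : Measure X} (h : preservingHomeo μ) (A : Set X) :
    μ.real ((h : X ≃ₜ X) '' A) = μ.real A := by
  have h2 : MeasurePreserving ((h : X ≃ₜ X).toMeasurableEquiv) μ μ := h.2
  have h3 := h2.measure_preimage_equiv ((h : X ≃ₜ X) '' A)
  have h4 : ((h : X ≃ₜ X).toMeasurableEquiv) ⁻¹' ((h : X ≃ₜ X) '' A) = A :=
    Set.preimage_image_eq A (h : X ≃ₜ X).injective
  rw [h4] at h3
  rw [measureReal_def, measureReal_def, h3]

/-! ### Stone duality for automorphisms of the clopen algebra -/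

/-- By compactness, the images under `φ` of the clopen neighbourhoods of a point have a common
point. -/
lemma exists_map_of_clopens_orderIso {X Y : Type*} [TopologicalSpace X] [TopologicalSpace Y]
    [CompactSpace Y] (φ : Clopens X ≃o Clopens Y) :
    ∃ f : X → Y, ∀ (x : X) (A : Clopens X), f x ∈ φ A ↔ x ∈ A := by
  have hne : ∀ x : X, (⋂ A : {A : Clopens X // x ∈ A}, (φ A : Set Y)).Nonempty := by
    intro x
    have : Nonempty {A : Clopens X // x ∈ A} := ⟨⟨⊤, Set.mem_univ x⟩⟩
    refine IsCompact.nonempty_iInter_of_directed_nonempty_isCompact_isClosed _ ?_ ?_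
      (fun A => (φ A).isClosed.isCompact) (fun A => (φ A).isClosed)
    · rintro ⟨A, hA⟩ ⟨B, hB⟩
      exact ⟨⟨A ⊓ B, hA, hB⟩, φ.monotone inf_le_left, φ.monotone inf_le_right⟩
    · rintro ⟨A, hA⟩
      rw [Set.nonempty_iff_ne_empty]
      intro h0
      have h1 : φ A = ⊥ := Clopens.ext h0
      rw [map_eq_bot_iff] at h1
      rw [h1] at hA
      exact hA
  choose f hf using hne
  have hmem : ∀ x (A : Clopens X), x ∈ A → f x ∈ φ A := fun x A hA => by
    have := Set.mem_iInter.1 (hf x) ⟨A, hA⟩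
    exact this
  refine ⟨f, fun x A => ⟨fun h => ?_, hmem x A⟩⟩
  by_contra hx
  have h1 := hmem x Aᶜ hx
  rw [map_compl'] at h1
  exact h1 h

/-- An automorphism of the clopen algebra of a compact space with a basis of clopen sets is induced
by a homeomorphism. -/
theorem exists_homeomorph_of_clopens_orderIso {X : Type*} [TopologicalSpace X] [CompactSpace X]
    [T0Space X] (hX : IsTopologicalBasis {U : Set X | IsClopen U}) (φ : Clopens X ≃o Clopens X) :
    ∃ f : X ≃ₜ X, ∀ A : Clopens X, f '' A = φ A := by
  have := totallySeparatedSpace_of_t0_of_basis_clopen hX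
  obtain ⟨f, hf⟩ := exists_map_of_clopens_orderIso φ
  obtain ⟨g, hg⟩ := exists_map_of_clopens_orderIso φ.symm
  have hsep : ∀ x y : X, (∀ A : Clopens X, x ∈ A ↔ y ∈ A) → x = y := fun x y h => by
    by_contra hxy
    obtain ⟨U, hU, hx, hy⟩ := exists_isClopen_of_totally_separated hxy
    exact hy ((h ⟨U, hU⟩).1 hx)
  have hg' : ∀ (y : X) (A : Clopens X), g y ∈ A ↔ y ∈ φ A := fun y A => by
    rw [← hg y (φ A), φ.symm_apply_apply]
  have hf' : ∀ (x : X) (B : Clopens X), f x ∈ B ↔ x ∈ φ.symm B := fun x B => by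
    rw [← hf x (φ.symm B), φ.apply_symm_apply]
  have hgf : ∀ x, g (f x) = x := fun x => hsep _ _ fun A => by rw [hg', hf]
  have hfg : ∀ y, f (g y) = y := fun y => hsep _ _ fun A => by rw [hf', hg]
  let F : X ≃ₜ X :=
    { toFun := f
      invFun := g
      left_inv := hgf
      right_inv := hfg
      continuous_toFun := hX.continuous_iff.2 fun U hU => by
        have : f ⁻¹' U = φ.symm ⟨U, hU⟩ := Set.ext fun x => hf' x ⟨U, hU⟩
        rw [this]
        exact (φ.symm ⟨U, hU⟩).isOpen
      continuous_invFun := hX.continuous_iff.2 fun U hU => by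
        have : g ⁻¹' U = φ ⟨U, hU⟩ := Set.ext fun x => hg' x ⟨U, hU⟩
        rw [this]
        exact (φ ⟨U, hU⟩).isOpen }
  refine ⟨F, fun A => ?_⟩
  ext y
  constructor
  · rintro ⟨x, hx, rfl⟩
    exact (hf x A).2 hx
  · intro hy
    exact ⟨g y, (hg' y A).2 hy, hfg y⟩

/-! ### Finite partial isomorphisms of the measured clopen algebra -/

/-- A finite partial isomorphism of the clopen algebra: two finite clopen partitions with a
measure-preserving matching of their pieces. It is encoded as a partition of the top element of the
Boolean algebra of pairs of clopen sets. The order is refinement, so that the smaller elements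
carry more information. -/
abbrev FinitePartialIso {X : Type*} [TopologicalSpace X] [MeasurableSpace X] (μ : Measure X) :=
  {P : Finpartition (⊤ : Clopens X × Clopens X) // ∀ p ∈ P.parts, μ.real p.1 = μ.real p.2}

/-- The homeomorphism `h` extends the partial isomorphism `P`. -/
def Extends {X : Type*} [TopologicalSpace X] [MeasurableSpace X] {μ : Measure X} (h : X ≃ₜ X)
    (P : FinitePartialIso μ) : Prop :=
  ∀ p ∈ P.1.parts, h '' p.1 = p.2

/-- The partial isomorphism `P` matches the clopen set `c.1` with the clopen set `c.2`: each pair of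
pieces lies inside `c`, or is disjoint from it. -/
def Decides {X : Type*} [TopologicalSpace X] [MeasurableSpace X] {μ : Measure X}
    (P : FinitePartialIso μ) (c : Clopens X × Clopens X) : Prop :=
  ∀ p ∈ P.1.parts, p ≤ c ∨ Disjoint p c

lemma IsClopenPartition.eq_top_of_forall_le {X ι : Type*} [TopologicalSpace X] {C : ι → Clopens X}
    (hC : IsClopenPartition C) {A : Clopens X} (h : ∀ i, C i ≤ A) : A = ⊤ :=
  top_le_iff.1 fun x _ => let ⟨i, hi⟩ := hC.exhaustive x; h i hi

namespace FinitePartialIso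

variable {X : Type*} [TopologicalSpace X] [MeasurableSpace X] {μ : Measure X}

lemma isClopenPartition_fst (P : FinitePartialIso μ) :
    IsClopenPartition fun p : P.1.parts => p.1.1 where
  disjoint p q hpq := (Prod.disjoint_iff.1
    (P.1.disjoint p.2 q.2 (fun h => hpq (Subtype.ext h)))).1
  exhaustive x := by
    have h : P.1.parts.sup Prod.fst = (⊤ : Clopens X) := by
      exact (Finset.apply_sup_eq_sup_comp Prod.fst (fun _ _ => rfl) rfl).symm.trans
        (congrArg Prod.fst P.1.sup_parts)
    have hx : x ∈ ((P.1.parts.sup Prod.fst : Clopens X) : Set X) := by rw [h]; trivial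
    rw [Clopens.coe_finset_sup] at hx
    simp only [mem_iUnion] at hx
    obtain ⟨p, hp, hx⟩ := hx
    exact ⟨⟨p, hp⟩, hx⟩

lemma isClopenPartition_snd (P : FinitePartialIso μ) :
    IsClopenPartition fun p : P.1.parts => p.1.2 where
  disjoint p q hpq := (Prod.disjoint_iff.1
    (P.1.disjoint p.2 q.2 (fun h => hpq (Subtype.ext h)))).2
  exhaustive x := by
    have h : P.1.parts.sup Prod.snd = (⊤ : Clopens X) := by
      exact (Finset.apply_sup_eq_sup_comp Prod.snd (fun _ _ => rfl) rfl).symm.trans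
        (congrArg Prod.snd P.1.sup_parts)
    have hx : x ∈ ((P.1.parts.sup Prod.snd : Clopens X) : Set X) := by rw [h]; trivial
    rw [Clopens.coe_finset_sup] at hx
    simp only [mem_iUnion] at hx
    obtain ⟨p, hp, hx⟩ := hx
    exact ⟨⟨p, hp⟩, hx⟩

open Classical in
/-- The partial isomorphism that matches the pieces of two indexed clopen partitions. -/
noncomputable def ofIndexed {ι : Type*} [Fintype ι] (C D : ι → Clopens X)
    (hC : IsClopenPartition C) (hD : IsClopenPartition D) (h : ∀ i, μ.real (C i) = μ.real (D i)) :
    FinitePartialIso μ :=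
  ⟨Finpartition.ofErase (Finset.univ.image fun i => (C i, D i))
    (by
      rw [Finset.supIndep_iff_pairwiseDisjoint]
      intro p hp q hq hpq
      simp only [Finset.coe_image, Finset.coe_univ, image_univ, mem_range] at hp hq
      obtain ⟨i, rfl⟩ := hp
      obtain ⟨j, rfl⟩ := hq
      have hij : i ≠ j := fun h => hpq (by rw [h])
      exact Prod.disjoint_iff.2 ⟨hC.disjoint i j hij, hD.disjoint i j hij⟩)
    (by
      have hle : ∀ i, (C i, D i) ≤ (Finset.univ.image fun i => (C i, D i)).sup id := fun i =>
        Finset.le_sup (f := id) (Finset.mem_image_of_mem _ (Finset.mem_univ i))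
      exact Prod.ext (hC.eq_top_of_forall_le fun i => (hle i).1)
        (hD.eq_top_of_forall_le fun i => (hle i).2)),
  by
    intro p hp
    obtain ⟨i, -, rfl⟩ := Finset.mem_image.1 (Finset.mem_of_mem_erase hp)
    exact h i⟩

section ofIndexed

variable {ι : Type*} [Fintype ι] {C D : ι → Clopens X} {hC : IsClopenPartition C}
  {hD : IsClopenPartition D} {hCD : ∀ i, μ.real (C i) = μ.real (D i)}

lemma exists_of_mem_ofIndexed {p : Clopens X × Clopens X}
    (hp : p ∈ (ofIndexed C D hC hD hCD).1.parts) : ∃ i, p = (C i, D i) := by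
  classical
  obtain ⟨i, -, rfl⟩ := Finset.mem_image.1 (Finset.mem_of_mem_erase hp)
  exact ⟨i, rfl⟩

lemma extends_ofIndexed_iff {h : X ≃ₜ X} :
    Extends h (ofIndexed C D hC hD hCD) ↔ ∀ i, h '' C i = D i := by
  classical
  constructor
  · intro H i
    by_cases hi : (C i, D i) = ⊥
    · rw [show C i = ⊥ from congrArg Prod.fst hi, show D i = ⊥ from congrArg Prod.snd hi]
      simp
    · exact H (C i, D i) (Finset.mem_erase.2 ⟨hi, Finset.mem_image_of_mem _ (Finset.mem_univ i)⟩)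
  · intro H p hp
    obtain ⟨i, rfl⟩ := exists_of_mem_ofIndexed hp
    exact H i

lemma ofIndexed_le {P : FinitePartialIso μ}
    (h : ∀ i, ∃ p ∈ P.1.parts, C i ≤ p.1 ∧ D i ≤ p.2) : ofIndexed C D hC hD hCD ≤ P := by
  intro q hq
  obtain ⟨i, rfl⟩ := exists_of_mem_ofIndexed hq
  exact h i

end ofIndexed

lemma _root_.Extends.mono {h : X ≃ₜ X} {P Q : FinitePartialIso μ} (H : Extends h Q) (hQ : Q ≤ P) :
    Extends h P := by
  -- every point of a piece of `P` lies in a piece of `Q`, and `P` has only one piece containing it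
  intro p hp
  apply Set.Subset.antisymm
  · rintro _ ⟨x, hx, rfl⟩
    obtain ⟨⟨q, hq⟩, hxq⟩ := Q.isClopenPartition_fst.exhaustive x
    obtain ⟨p', hp', hqp⟩ := hQ hq
    have hpp : (⟨p', hp'⟩ : P.1.parts) = ⟨p, hp⟩ :=
      P.isClopenPartition_fst.eq_of_mem (x := x) (hqp.1 hxq) hx
    obtain rfl : p' = p := congrArg Subtype.val hpp
    refine hqp.2 ?_
    change h x ∈ (q.2 : Set X)
    rw [← H q hq]
    exact mem_image_of_mem h hxq
  · intro y hy
    obtain ⟨⟨q, hq⟩, hyq⟩ := Q.isClopenPartition_snd.exhaustive y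
    obtain ⟨p', hp', hqp⟩ := hQ hq
    have hpp : (⟨p', hp'⟩ : P.1.parts) = ⟨p, hp⟩ :=
      P.isClopenPartition_snd.eq_of_mem (x := y) (hqp.2 hyq) hy
    obtain rfl : p' = p := congrArg Subtype.val hpp
    change y ∈ (q.2 : Set X) at hyq
    rw [← H q hq] at hyq
    exact image_mono hqp.1 hyq

lemma _root_.Decides.mono {P Q : FinitePartialIso μ} {c : Clopens X × Clopens X} (H : Decides P c)
    (hQ : Q ≤ P) : Decides Q c := by
  intro q hq
  obtain ⟨p, hp, hqp⟩ := hQ hq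
  exact (H p hp).imp hqp.trans fun h => h.mono_left hqp

lemma decides_of_mem (P : FinitePartialIso μ) {p : Clopens X × Clopens X} (hp : p ∈ P.1.parts) :
    Decides P p := by
  intro q hq
  by_cases h : q = p
  · exact Or.inl h.le
  · exact Or.inr (P.1.disjoint hq hp h)

/-- Cutting all pieces of `P` along `c` gives a refinement, provided that the two halves of each
piece keep matching measures. -/
lemma exists_le_decides [BorelSpace X] [IsFiniteMeasure μ] (P : FinitePartialIso μ)
    (c : Clopens X × Clopens X)
    (hc : ∀ p ∈ P.1.parts, μ.real (p.1 ⊓ c.1 : Clopens X) = μ.real (p.2 ⊓ c.2 : Clopens X)) :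
    ∃ Q ≤ P, Decides Q c := by
  have hpart : ∀ (A : P.1.parts → Clopens X) (B : Clopens X), IsClopenPartition A →
      IsClopenPartition fun i : P.1.parts × Bool => if i.2 then A i.1 ⊓ B else A i.1 \ B := by
    intro A B hA
    refine ⟨?_, fun x => ?_⟩
    · rintro ⟨i, s⟩ ⟨j, t⟩ hij
      have hle : ∀ (i : P.1.parts) (s : Bool), (if s then A i ⊓ B else A i \ B) ≤ A i := by
        rintro i (_ | _)
        exacts [sdiff_le, inf_le_left]
      by_cases h : i = j
      · subst h
        rcases s with _ | _ <;> rcases t with _ | _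
        · exact absurd rfl hij
        · exact disjoint_sdiff_self_left.mono_right inf_le_right
        · exact disjoint_sdiff_self_right.mono_left inf_le_right
        · exact absurd rfl hij
      · exact (hA.disjoint i j h).mono (hle i s) (hle j t)
    · obtain ⟨i, hi⟩ := hA.exhaustive x
      by_cases hx : x ∈ B
      · exact ⟨(i, true), hi, hx⟩
      · exact ⟨(i, false), hi, hx⟩
  refine ⟨ofIndexed _ _ (hpart (fun p => p.1.1) c.1 P.isClopenPartition_fst)
    (hpart (fun p => p.1.2) c.2 P.isClopenPartition_snd) ?_, ?_, ?_⟩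
  · rintro ⟨p, _ | _⟩
    · have h1 : ∀ A B : Clopens X, μ.real (A \ B : Clopens X)
          = μ.real A - μ.real (A ⊓ B : Clopens X) := fun A B => by
        have := measureReal_inter_add_sdiff (μ := μ) (s := (A : Set X)) B.isOpen.measurableSet
        rw [Clopens.coe_sdiff, Clopens.coe_inf]
        linarith
      simp only [Bool.false_eq_true, if_false]
      rw [h1, h1, hc p.1 p.2, P.2 p.1 p.2]
    · exact hc p.1 p.2
  · refine ofIndexed_le ?_
    rintro ⟨p, _ | _⟩
    · exact ⟨p.1, p.2, sdiff_le, sdiff_le⟩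
    · exact ⟨p.1, p.2, inf_le_left, inf_le_left⟩
  · intro q hq
    obtain ⟨⟨p, _ | _⟩, rfl⟩ := exists_of_mem_ofIndexed hq
    · exact Or.inr (Prod.disjoint_iff.2 ⟨disjoint_sdiff_self_left, disjoint_sdiff_self_left⟩)
    · exact Or.inl ⟨inf_le_right, inf_le_right⟩

/-- A clopen set can cut the pieces of a finite partition in any prescribed proportions. -/
lemma _root_.IsGoodMeasure.exists_clopen_inter (hμ : IsGoodMeasure μ) {ι : Type*} [Fintype ι]
    {D : ι → Clopens X} (hD : IsClopenPartition D) (r : ι → ℝ)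
    (hr : ∀ i, r i ∈ clopenValueSet μ) (hle : ∀ i, r i ≤ μ.real (D i)) :
    ∃ B : Clopens X, ∀ i, μ.real (D i ⊓ B : Clopens X) = r i := by
  choose b hbD hb using fun i => hμ.exists_clopen_le (hr i) (D i) (hle i)
  refine ⟨Finset.univ.sup b, fun i => ?_⟩
  have : D i ⊓ Finset.univ.sup b = b i := by
    refine le_antisymm ?_ (le_inf (hbD i) (Finset.le_sup (Finset.mem_univ i)))
    rintro x ⟨hx, hxb⟩
    rw [Clopens.coe_finset_sup] at hxb
    simp only [mem_iUnion] at hxb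
    obtain ⟨j, -, hxj⟩ := hxb
    rwa [hD.eq_of_mem hx (hbD j hxj)]
  rw [this, hb]

lemma exists_le_decides_fst [BorelSpace X] (hμ : IsGoodMeasure μ) (P : FinitePartialIso μ)
    (A : Clopens X) :
    ∃ Q ≤ P, ∃ B, Decides Q (A, B) := by
  have := hμ.isProbability
  obtain ⟨B, hB⟩ := hμ.exists_clopen_inter P.isClopenPartition_snd
    (fun p => μ.real (p.1.1 ⊓ A : Clopens X)) (fun p => ⟨_, (p.1.1 ⊓ A).isClopen, rfl⟩)
    (fun p => (measureReal_mono inter_subset_left).trans_eq (P.2 p.1 p.2))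
  obtain ⟨Q, hQ, h⟩ := P.exists_le_decides (A, B) fun p hp => (hB ⟨p, hp⟩).symm
  exact ⟨Q, hQ, B, h⟩

lemma exists_le_decides_snd [BorelSpace X] (hμ : IsGoodMeasure μ) (P : FinitePartialIso μ)
    (B : Clopens X) :
    ∃ Q ≤ P, ∃ A, Decides Q (A, B) := by
  have := hμ.isProbability
  obtain ⟨A, hA⟩ := hμ.exists_clopen_inter P.isClopenPartition_fst
    (fun p => μ.real (p.1.2 ⊓ B : Clopens X)) (fun p => ⟨_, (p.1.2 ⊓ B).isClopen, rfl⟩)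
    (fun p => (measureReal_mono inter_subset_left).trans_eq (P.2 p.1 p.2).symm)
  obtain ⟨Q, hQ, h⟩ := P.exists_le_decides (A, B) fun p hp => hA ⟨p, hp⟩
  exact ⟨Q, hQ, A, h⟩

lemma measureReal_eq_of_decides [BorelSpace X] [IsFiniteMeasure μ] {P : FinitePartialIso μ}
    {c : Clopens X × Clopens X} (h : Decides P c) : μ.real c.1 = μ.real c.2 := by
  rw [← P.isClopenPartition_fst.sum_measureReal_inter μ c.1.isOpen.measurableSet,
    ← P.isClopenPartition_snd.sum_measureReal_inter μ c.2.isOpen.measurableSet]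
  refine Finset.sum_congr rfl fun p _ => ?_
  rcases h p.1 p.2 with hle | hd
  · rw [inter_eq_self_of_subset_right hle.1, inter_eq_self_of_subset_right hle.2, P.2 p.1 p.2]
  · obtain ⟨h1, h2⟩ := Prod.disjoint_iff.1 hd
    rw [(Clopens.coe_disjoint.2 h1).symm.inter_eq, (Clopens.coe_disjoint.2 h2).symm.inter_eq]

lemma fst_eq_bot_iff (hμ : IsGoodMeasure μ) (P : FinitePartialIso μ) {p : Clopens X × Clopens X}
    (hp : p ∈ P.1.parts) : p.1 = ⊥ ↔ p.2 = ⊥ := by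
  constructor
  · intro h
    apply hμ.eq_bot_of_measureReal_eq_zero
    rw [← P.2 p hp, h]
    simp
  · intro h
    apply hμ.eq_bot_of_measureReal_eq_zero
    rw [P.2 p hp, h]
    simp

/-- The matching of clopen sets by a partial isomorphism preserves and reflects inclusion. -/
lemma le_iff_of_decides (hμ : IsGoodMeasure μ) {P : FinitePartialIso μ}
    {c d : Clopens X × Clopens X} (hc : Decides P c) (hd : Decides P d) :
    c.1 ≤ d.1 ↔ c.2 ≤ d.2 := by
  constructor
  · intro hle y hy
    obtain ⟨⟨p, hp⟩, hyp⟩ := P.isClopenPartition_snd.exhaustive y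
    rcases hc p hp with h | h
    · rcases hd p hp with h' | h'
      · exact h'.2 hyp
      · have h1 : p.1 = ⊥ := disjoint_self.1
          ((Prod.disjoint_iff.1 h').1.mono_right (h.1.trans hle))
        rw [(fst_eq_bot_iff hμ P hp).1 h1] at hyp
        exact hyp.elim
    · exact absurd hy (Clopens.disjoint_iff_forall.1 (Prod.disjoint_iff.1 h).2 y hyp)
  · intro hle y hy
    obtain ⟨⟨p, hp⟩, hyp⟩ := P.isClopenPartition_fst.exhaustive y
    rcases hc p hp with h | h
    · rcases hd p hp with h' | h'
      · exact h'.1 hyp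
      · have h1 : p.2 = ⊥ := disjoint_self.1
          ((Prod.disjoint_iff.1 h').2.mono_right (h.2.trans hle))
        rw [(fst_eq_bot_iff hμ P hp).2 h1] at hyp
        exact hyp.elim
    · exact absurd hy (Clopens.disjoint_iff_forall.1 (Prod.disjoint_iff.1 h).1 y hyp)

end FinitePartialIso

/-! ### Generic measure-preserving homeomorphisms -/

section Generic

variable {X : Type*} [TopologicalSpace X] [MeasurableSpace X] {μ : Measure X}

lemma measurePreserving_of_clopens [BorelSpace X] (hX : IsCantorSpace X) [IsFiniteMeasure μ]
    (f : X ≃ₜ X) (hf : ∀ A : Clopens X, μ.real (f '' A) = μ.real A) : MeasurePreserving f μ μ := by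
  have := hX.compact
  have := hX.metrizable
  refine ⟨f.continuous.measurable, ?_⟩
  have key : ∀ U : Set X, IsClopen U → Measure.map f μ U = μ U := fun U hU => by
    rw [Measure.map_apply f.continuous.measurable hU.isOpen.measurableSet]
    have h1 := hf ⟨f ⁻¹' U, hU.preimage f.continuous⟩
    have h2 : f '' (f ⁻¹' U) = U := f.surjective.image_preimage U
    change μ.real (f '' (f ⁻¹' U)) = μ.real (f ⁻¹' U) at h1
    rw [h2] at h1
    exact ((measureReal_eq_measureReal_iff).1 h1).symm
  refine ext_of_generate_finite {U : Set X | IsClopen U} ?_ ?_ key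
    (key _ isClopen_univ)
  · rw [BorelSpace.measurable_eq (α := X), hX.zeroDim.borel_eq_generateFrom]
  · exact fun U hU W hW _ => hU.inter hW

lemma countable_finitePartialIso (hX : IsCantorSpace X) : Countable (FinitePartialIso μ) := by
  have := hX.compact
  have := hX.metrizable
  have := totallySeparatedSpace_of_t0_of_basis_clopen hX.zeroDim
  have : Countable (Clopens X) := Clopens.countable_iff_secondCountable.2 inferInstance
  have hinj : Function.Injective fun P : FinitePartialIso μ => P.1.parts :=
    fun P Q h => Subtype.ext (Finpartition.ext h)
  exact hinj.countable

/-- Given countably many dense sets of finite partial isomorphisms, a generic back-and-forth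
construction, started at any prescribed partial isomorphism, yields an element of `H_μ` that
extends some member of each dense set. -/
theorem exists_generic_extension [BorelSpace X] (hX : IsCantorSpace X) (hμ : IsGoodMeasure μ)
    {J : Type*} [Countable J] (D : J → Set (FinitePartialIso μ)) (hD : ∀ j P, ∃ Q ≤ P, Q ∈ D j)
    (P₀ : FinitePartialIso μ) :
    ∃ h : preservingHomeo μ, Extends (h : X ≃ₜ X) P₀ ∧
      ∀ j, ∃ Q ∈ D j, Extends (h : X ≃ₜ X) Q := by
  have := hX.compact
  have := hX.metrizable
  have := hμ.isProbability
  have := totallySeparatedSpace_of_t0_of_basis_clopen hX.zeroDim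
  have : Countable (Clopens X) := Clopens.countable_iff_secondCountable.2 inferInstance
  have := Encodable.ofCountable (J ⊕ Clopens X ⊕ Clopens X)
  let 𝒟 : J ⊕ Clopens X ⊕ Clopens X → Order.Cofinal (FinitePartialIso μ)ᵒᵈ := fun k =>
    match k with
    | .inl j => ⟨OrderDual.ofDual ⁻¹' D j, fun P => let ⟨Q, hQ, h⟩ := hD j P.ofDual
        ⟨OrderDual.toDual Q, h, hQ⟩⟩
    | .inr (.inl A) => ⟨{P | ∃ B, Decides P.ofDual (A, B)}, fun P =>
        let ⟨Q, hQ, h⟩ := FinitePartialIso.exists_le_decides_fst hμ P.ofDual A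
        ⟨OrderDual.toDual Q, h, hQ⟩⟩
    | .inr (.inr B) => ⟨{P | ∃ A, Decides P.ofDual (A, B)}, fun P =>
        let ⟨Q, hQ, h⟩ := FinitePartialIso.exists_le_decides_snd hμ P.ofDual B
        ⟨OrderDual.toDual Q, h, hQ⟩⟩
  let I := Order.idealOfCofinals (OrderDual.toDual P₀) 𝒟
  have hmeet := Order.cofinal_meets_idealOfCofinals (OrderDual.toDual P₀) 𝒟
  have hP₀ : OrderDual.toDual P₀ ∈ I := Order.mem_idealOfCofinals _ _
  -- the matching of clopen sets decided by the generic ideal is an automorphism of the algebra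
  let R : Clopens X × Clopens X → Prop := fun c =>
    ∃ P : FinitePartialIso μ, OrderDual.toDual P ∈ I ∧ Decides P c
  have hle : ∀ c d, R c → R d → (c.1 ≤ d.1 ↔ c.2 ≤ d.2) := by
    rintro c d ⟨P, hP, hPc⟩ ⟨Q, hQ, hQd⟩
    obtain ⟨S, -, hSP, hSQ⟩ := I.directed _ hP _ hQ
    exact FinitePartialIso.le_iff_of_decides hμ (P := S.ofDual) (hPc.mono hSP) (hQd.mono hSQ)
  have hleft : ∀ A, ∃ B, R (A, B) := fun A => by
    obtain ⟨P, ⟨B, hB⟩, hP⟩ := hmeet (.inr (.inl A))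
    exact ⟨B, P.ofDual, hP, hB⟩
  have hright : ∀ B, ∃ A, R (A, B) := fun B => by
    obtain ⟨P, ⟨A, hA⟩, hP⟩ := hmeet (.inr (.inr B))
    exact ⟨A, P.ofDual, hP, hA⟩
  choose φ hφ using hleft
  have hφu : ∀ A B, R (A, B) → φ A = B := fun A B h =>
    le_antisymm ((hle _ _ (hφ A) h).1 le_rfl) ((hle _ _ h (hφ A)).1 le_rfl)
  let Φ : Clopens X ≃o Clopens X := RelIso.ofSurjective
    (OrderEmbedding.ofMapLEIff φ fun A B => (hle _ _ (hφ A) (hφ B)).symm)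
    fun B => let ⟨A, hA⟩ := hright B; ⟨A, hφu A B hA⟩
  obtain ⟨f, hf⟩ := exists_homeomorph_of_clopens_orderIso hX.zeroDim Φ
  have hf' : ∀ A : Clopens X, f '' A = φ A := hf
  have hext : ∀ P : FinitePartialIso μ, OrderDual.toDual P ∈ I → Extends f P := fun P hP p hp => by
    rw [hf', hφu p.1 p.2 ⟨P, hP, P.decides_of_mem hp⟩]
  refine ⟨⟨f, measurePreserving_of_clopens hX f fun A => ?_⟩, hext P₀ hP₀, fun j => ?_⟩
  · rw [hf']
    obtain ⟨P, -, hP⟩ := hφ A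
    exact (FinitePartialIso.measureReal_eq_of_decides hP).symm
  · obtain ⟨Q, hQ, hQI⟩ := hmeet (.inl j)
    exact ⟨Q.ofDual, hQ, hext _ hQI⟩

/-- Every finite partial isomorphism extends to an element of `H_μ`. -/
theorem exists_extends [BorelSpace X] (hX : IsCantorSpace X) (hμ : IsGoodMeasure μ)
    (P : FinitePartialIso μ) :
    ∃ h : preservingHomeo μ, Extends (h : X ≃ₜ X) P :=
  let ⟨h, hP, _⟩ := exists_generic_extension hX hμ (J := Empty) (fun j => j.elim)
    (fun j => j.elim) P
  ⟨h, hP⟩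

end Generic

section MainArgument

variable {X : Type*} [TopologicalSpace X] [MeasurableSpace X] {μ : Measure X} {V : Set ℝ}

/-! ### Cyclic refinements -/

/-- Every finite partial isomorphism is refined by one that permutes the pieces of a single clopen
partition.

If `p` and `q` are two pairs of matched pieces, let `w q p` be the measure of `q.2 ∩ p.1`: this is a
circulation, since the measures of `p.1` and `p.2` agree. The permutation is the one that carries
this circulation, and the sets `q.2 ∩ p.1` are cut into pieces accordingly. -/
theorem FinitePartialIso.exists_cyclic_refinement.{u} {X : Type u} [TopologicalSpace X]
    [MeasurableSpace X] [BorelSpace X] {μ : Measure X} (hV : IsGroupLike V) (hμ : IsGoodMeasure μ)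
    (hμV : clopenValueSet μ = V) (P : FinitePartialIso μ) :
    ∃ (ι : Type u) (_ : Fintype ι) (σ : Equiv.Perm ι) (C : ι → Clopens X),
      IsClopenPartition C ∧ (∀ x, μ.real (C (σ x)) = μ.real (C x)) ∧
      ∀ x, ∃ p ∈ P.1.parts, C x ≤ p.1 ∧ C (σ x) ≤ p.2 := by
  classical
  have := hμ.isProbability
  let w : P.1.parts → P.1.parts → ℝ := fun q p => μ.real ((q.1.2 ⊓ p.1.1 : Clopens X) : Set X)
  have hwV : ∀ q p, w q p ∈ V := fun q p => measureReal_mem_of_isClopen hμV (q.1.2 ⊓ p.1.1).isClopen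
  obtain ⟨ι, _, σ, π, a, haG, ha0, hσ, hw⟩ := exists_weighted_perm_of_circulation
    (AddSubgroup.closure (V ∪ {1})) w (fun q p => IsGroupLike.mem_closure (hwV q p))
    (fun q p => measureReal_nonneg) (fun p => by
      have h1 := P.isClopenPartition_fst.sum_measureReal_inter μ p.1.2.isOpen.measurableSet
      have h2 := P.isClopenPartition_snd.sum_measureReal_inter μ p.1.1.isOpen.measurableSet
      rw [← P.2 p.1 p.2, ← h2] at h1
      refine h1.trans (Finset.sum_congr rfl fun q _ => ?_)
      simp only [w, Clopens.coe_inf, inter_comm])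
  have haV : ∀ x, a x ∈ V := fun x => by
    refine hV.mem_iff.2 ⟨haG x, (ha0 x).le, ?_⟩
    refine le_trans ?_ (hV.mem_iff.1 (hwV (π x) (π (σ x)))).2.2
    rw [hw]
    refine le_trans (by simp) (Finset.single_le_sum
      (f := fun y => if π y = π x ∧ π (σ y) = π (σ x) then a y else 0)
      (fun y _ => by split_ifs <;> [exact (ha0 y).le; rfl]) (Finset.mem_univ x))
  have hpart : IsClopenPartition fun e : P.1.parts × P.1.parts => e.1.1.2 ⊓ e.2.1.1 := by
    refine ⟨?_, fun x => ?_⟩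
    · rintro ⟨q, p⟩ ⟨q', p'⟩ hne
      by_cases hq : q = q'
      · have hp : p ≠ p' := fun h => hne (by rw [hq, h])
        exact (P.isClopenPartition_fst.disjoint p p' hp).mono inf_le_right inf_le_right
      · exact (P.isClopenPartition_snd.disjoint q q' hq).mono inf_le_left inf_le_left
    · obtain ⟨q, hq⟩ := P.isClopenPartition_snd.exhaustive x
      obtain ⟨p, hp⟩ := P.isClopenPartition_fst.exhaustive x
      exact ⟨(q, p), hq, hp⟩
  obtain ⟨C, hC, hCle, hCa⟩ := hμ.exists_refinement hpart (fun x => (π x, π (σ x))) a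
    (fun x => hμV ▸ haV x) (fun e => by
      rw [Finset.sum_filter]
      simp only [Prod.ext_iff]
      exact (hw e.1 e.2).symm)
  refine ⟨ι, inferInstance, σ, C, hC, fun x => by rw [hCa, hCa, hσ], fun x => ?_⟩
  exact ⟨(π (σ x)).1, (π (σ x)).2, (hCle x).trans inf_le_right, (hCle (σ x)).trans inf_le_left⟩

/-! ### Basic open subsets of `H_μ` -/

/-- The homeomorphisms that extend a finite partial isomorphism form an open set. -/
lemma isOpen_setOf_extends [BorelSpace X] (P : FinitePartialIso μ) :
    IsOpen {g : preservingHomeo μ | Extends (g : X ≃ₜ X) P} := by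
  have h1 : {g : preservingHomeo μ | Extends (g : X ≃ₜ X) P}
      = Subtype.val ⁻¹' ⋂ p ∈ P.1.parts, {g : X ≃ₜ X | g '' p.1 = p.2} := by
    ext g
    simp [Extends]
  rw [h1]
  refine IsOpen.preimage continuous_subtype_val (isOpen_biInter_finset fun p _ => ?_)
  exact isOpen_generateFrom_of_mem ⟨p.1, p.2, p.1.isClopen, p.2.isClopen, rfl⟩

/-- The restriction of an element of `H_μ` to a finite clopen partition. -/
lemma exists_finitePartialIso_of_partition [BorelSpace X] (f : preservingHomeo μ)
    {ι : Type*} [Fintype ι] {C : ι → Clopens X} (hC : IsClopenPartition C) :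
    ∃ P : FinitePartialIso μ, Extends (f : X ≃ₜ X) P ∧
      ∀ g : X ≃ₜ X, Extends g P → ∀ i, g '' C i = (f : X ≃ₜ X) '' C i := by
  let D : ι → Clopens X := fun i =>
    ⟨(f : X ≃ₜ X) '' C i, (f : X ≃ₜ X).isClosed_image.2 (C i).isClosed,
      (f : X ≃ₜ X).isOpen_image.2 (C i).isOpen⟩
  have hCD : ∀ i, (f : X ≃ₜ X) '' C i = D i := fun i => rfl
  exact ⟨.ofIndexed C D hC (hC.image f hCD) fun i => (measureReal_image_eq f _).symm,
    FinitePartialIso.extends_ofIndexed_iff.2 hCD,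
    fun g hg => FinitePartialIso.extends_ofIndexed_iff.1 hg⟩

/-- The sets of extensions of finite partial isomorphisms form a basis of the topology of `H_μ`: a
neighbourhood is controlled by the images of finitely many clopen sets, hence by the images of the
pieces of the partition that these sets generate. -/
lemma exists_extends_subset_of_isOpen [BorelSpace X] {O : Set (preservingHomeo μ)} (hO : IsOpen O)
    {f : preservingHomeo μ} (hf : f ∈ O) :
    ∃ P : FinitePartialIso μ, Extends (f : X ≃ₜ X) P ∧
      ∀ g : preservingHomeo μ, Extends (g : X ≃ₜ X) P → g ∈ O := by
  obtain ⟨O', hO', rfl⟩ := isOpen_induced_iff.1 hO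
  -- it suffices to find a finite family of clopen sets whose images determine membership in `O'`
  suffices h : ∃ s : Finset (Clopens X), ∀ g : X ≃ₜ X,
      (∀ A ∈ s, g '' A = (f : X ≃ₜ X) '' A) → g ∈ O' by
    classical
    obtain ⟨s, hs⟩ := h
    -- the atoms of the algebra generated by `s`, indexed by the sets of `s` that contain them
    let C : (s → Bool) → Clopens X := fun t =>
      Finset.univ.inf fun A : s => if t A then (A : Clopens X) else (A : Clopens X)ᶜ
    have hmem : ∀ x t, x ∈ C t ↔ ∀ A : s, t A = true ↔ x ∈ (A : Clopens X) := by
      intro x t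
      have h1 : x ∈ C t ↔ ∀ A : s, x ∈ (if t A then (A : Clopens X) else (A : Clopens X)ᶜ) := by
        have h2 : ∀ u : Finset s, x ∈ u.inf (fun A : s =>
            if t A then (A : Clopens X) else (A : Clopens X)ᶜ) ↔
            ∀ A ∈ u, x ∈ (if t A then (A : Clopens X) else (A : Clopens X)ᶜ) := by
          intro u
          induction u using Finset.induction_on with
          | empty =>
            rw [Finset.inf_empty]
            exact ⟨fun _ A hA => absurd hA (Finset.notMem_empty A), fun _ => Set.mem_univ x⟩
          | insert A u _ ih =>
            rw [Finset.inf_insert, Finset.forall_mem_insert, ← ih]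
            exact Iff.rfl
        exact (h2 Finset.univ).trans ⟨fun h A => h A (Finset.mem_univ A), fun h A _ => h A⟩
      rw [h1]
      refine forall_congr' fun A => ?_
      cases t A with
      | true => simp
      | false =>
        simp only [Bool.false_eq_true, if_false, false_iff]
        exact Iff.rfl
    have hC : IsClopenPartition C := by
      refine ⟨fun t u htu => Clopens.disjoint_iff_forall.2 fun x ht hu => htu ?_, fun x => ?_⟩
      · funext A
        exact Bool.eq_iff_iff.2 (((hmem x t).1 ht A).trans ((hmem x u).1 hu A).symm)
      · exact ⟨fun A => decide (x ∈ (A : Clopens X)), (hmem _ _).2 fun A => by simp⟩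
    obtain ⟨P, hP, hPC⟩ := exists_finitePartialIso_of_partition f hC
    refine ⟨P, hP, fun g hg => hs g fun A hA => ?_⟩
    have hA' : (A : Set X) = ⋃ t : {t : s → Bool // t ⟨A, hA⟩ = true}, (C t : Set X) := by
      ext x
      simp only [mem_iUnion]
      constructor
      · intro hx
        obtain ⟨t, ht⟩ := hC.exhaustive x
        exact ⟨⟨t, ((hmem x t).1 ht ⟨A, hA⟩).2 hx⟩, ht⟩
      · rintro ⟨⟨t, hta⟩, ht⟩
        exact ((hmem x t).1 ht ⟨A, hA⟩).1 hta
    rw [hA', image_iUnion, image_iUnion]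
    exact iUnion_congr fun t => hPC g hg t
  clear hO
  change (f : X ≃ₜ X) ∈ O' at hf
  induction hO' with
  | basic S hS =>
    obtain ⟨U, W, hU, hW, rfl⟩ := hS
    refine ⟨{⟨U, hU⟩}, fun g hg => ?_⟩
    have := hg ⟨U, hU⟩ (Finset.mem_singleton_self _)
    exact this.trans hf
  | univ => exact ⟨∅, fun g _ => trivial⟩
  | inter S T _ _ ihS ihT =>
    classical
    obtain ⟨s, hs⟩ := ihS hf.1
    obtain ⟨t, ht⟩ := ihT hf.2
    exact ⟨s ∪ t, fun g hg => ⟨hs g fun A hA => hg A (Finset.mem_union_left _ hA),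
      ht g fun A hA => hg A (Finset.mem_union_right _ hA)⟩⟩
  | sUnion 𝒮 _ ih =>
    obtain ⟨S, hS, hfS⟩ := hf
    obtain ⟨s, hs⟩ := ih S hS hfS
    exact ⟨s, fun g hg => ⟨S, hS, hs g hg⟩⟩

/-! ### Dense conjugacy classes and joinings -/

lemma coe_conj_image [BorelSpace X] (k g : preservingHomeo μ) (A : Set X) :
    ((k * g * k⁻¹ : preservingHomeo μ) : X ≃ₜ X) '' ((k : X ≃ₜ X) '' A)
      = (k : X ≃ₜ X) '' ((g : X ≃ₜ X) '' A) := by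
  have h1 : ∀ x, ((k * g * k⁻¹ : preservingHomeo μ) : X ≃ₜ X) ((k : X ≃ₜ X) x)
      = (k : X ≃ₜ X) ((g : X ≃ₜ X) x) := fun x =>
    congrArg (fun y => (k : X ≃ₜ X) ((g : X ≃ₜ X) y)) ((k : X ≃ₜ X).symm_apply_apply x)
  simp only [image_image, h1]

/-- If invariant joinings exist, then every `Q` has a refinement all of whose extensions are
conjugate to extensions of `P`, by a conjugator that does not depend on the extension. -/
lemma HasInvariantJoinings.exists_le_conj.{u} {X : Type u} [TopologicalSpace X]
    [MeasurableSpace X] [BorelSpace X] {μ : Measure X} (hX : IsCantorSpace X)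
    (hV : IsGroupLike V) (hμ : IsGoodMeasure μ) (hμV : clopenValueSet μ = V)
    (hJ : HasInvariantJoinings.{u, u} V) (P Q : FinitePartialIso μ) :
    ∃ R ≤ Q, ∃ k : preservingHomeo μ, ∀ g : preservingHomeo μ, Extends (g : X ≃ₜ X) R →
      Extends ((k * g * k⁻¹ : preservingHomeo μ) : X ≃ₜ X) P := by
  classical
  have := hμ.isProbability
  obtain ⟨ι, _, σ, C, hC, hσ, hCP⟩ := P.exists_cyclic_refinement hV hμ hμV
  obtain ⟨κ, _, τ, D, hD, hτ, hDQ⟩ := Q.exists_cyclic_refinement hV hμ hμV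
  obtain ⟨c, hcV, hc, hrow, hcol⟩ := hJ ι κ σ τ (fun x => μ.real (C x)) (fun y => μ.real (D y))
    (fun x => measureReal_mem_of_isClopen hμV (C x).isClopen)
    (fun y => measureReal_mem_of_isClopen hμV (D y).isClopen) hσ hτ (hC.sum_measureReal μ)
    (hD.sum_measureReal μ)
  let ρ : Equiv.Perm (ι × κ) := σ.prodCongr τ
  have hcV' : ∀ z : ι × κ, c z.1 z.2 ∈ clopenValueSet μ := fun z => hμV ▸ hcV _ _
  obtain ⟨E, hE, hEC, hEc⟩ := hμ.exists_refinement hC Prod.fst (fun z : ι × κ => c z.1 z.2) hcV'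
    fun x => by
      rw [← hrow x, Finset.sum_filter, Fintype.sum_prod_type]
      simp [Finset.sum_ite_irrel]
  obtain ⟨F, hF, hFD, hFc⟩ := hμ.exists_refinement hD Prod.snd (fun z : ι × κ => c z.1 z.2) hcV'
    fun y => by
      rw [← hcol y, Finset.sum_filter, Fintype.sum_prod_type]
      simp
  obtain ⟨k, hk⟩ := exists_extends hX hμ (FinitePartialIso.ofIndexed F E hF hE fun z => by
    rw [hFc, hEc])
  have hk' := FinitePartialIso.extends_ofIndexed_iff.1 hk
  refine ⟨.ofIndexed F (F ∘ ρ) hF (hF.comp_perm ρ) fun z => ?_,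
    FinitePartialIso.ofIndexed_le fun z => ?_, k, fun g hg => ?_⟩
  · simp only [Function.comp_apply, hFc]
    exact (hc z.1 z.2).symm
  · obtain ⟨q, hq, h1, h2⟩ := hDQ z.2
    exact ⟨q, hq, (hFD z).trans h1, (hFD (ρ z)).trans h2⟩
  · have hg' := FinitePartialIso.extends_ofIndexed_iff.1 hg
    have hext : Extends ((k * g * k⁻¹ : preservingHomeo μ) : X ≃ₜ X)
        (FinitePartialIso.ofIndexed (μ := μ) E (E ∘ ρ) hE (hE.comp_perm ρ) fun z => by
          simp only [Function.comp_apply, hEc]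
          exact (hc z.1 z.2).symm) := by
      refine FinitePartialIso.extends_ofIndexed_iff.2 fun z => ?_
      rw [← hk' z, coe_conj_image, hg' z]
      exact hk' (ρ z)
    refine hext.mono (FinitePartialIso.ofIndexed_le fun z => ?_)
    obtain ⟨p, hp, h1, h2⟩ := hCP z.1
    exact ⟨p, hp, (hEC z).trans h1, (hEC (ρ z)).trans h2⟩

theorem HasInvariantJoinings.hasDenseConjugacyClass.{u} {X : Type u} [TopologicalSpace X]
    [MeasurableSpace X] [BorelSpace X] {μ : Measure X} (hX : IsCantorSpace X)
    (hV : IsGroupLike V) (hμ : IsGoodMeasure μ) (hμV : clopenValueSet μ = V)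
    (hJ : HasInvariantJoinings.{u, u} V) : HasDenseConjugacyClass (preservingHomeo μ) := by
  have := countable_finitePartialIso (μ := μ) hX
  obtain ⟨P₀, -⟩ := exists_extends_subset_of_isOpen (μ := μ) isOpen_univ (mem_univ 1)
  obtain ⟨g, -, hg⟩ := exists_generic_extension hX hμ
    (fun P : FinitePartialIso μ => {R : FinitePartialIso μ | ∃ k : preservingHomeo μ,
      ∀ g : preservingHomeo μ, Extends (g : X ≃ₜ X) R →
        Extends ((k * g * k⁻¹ : preservingHomeo μ) : X ≃ₜ X) P})
    (fun P Q => hJ.exists_le_conj hX hV hμ hμV P Q) P₀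
  refine ⟨g, dense_iff_inter_open.2 fun O hO ⟨f, hf⟩ => ?_⟩
  obtain ⟨P, -, hP⟩ := exists_extends_subset_of_isOpen hO hf
  obtain ⟨R, ⟨k, hk⟩, hR⟩ := hg P
  exact ⟨k * g * k⁻¹, hP _ (hk g hR), isConj_iff.2 ⟨k, rfl⟩⟩

/-- A homeomorphism with a dense conjugacy class realises every weighted permutation with weights in
the value set as its action on the pieces of some clopen partition. -/
lemma exists_partition_of_dense_conjugatesOf [BorelSpace X] (hX : IsCantorSpace X)
    (hμ : IsGoodMeasure μ) {g : preservingHomeo μ} (hg : Dense (conjugatesOf g)) {T : Type*}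
    [Fintype T] (ρ : Equiv.Perm T) (r : T → ℝ) (hr : ∀ t, r t ∈ clopenValueSet μ)
    (hρ : ∀ t, r (ρ t) = r t) (hsum : ∑ t, r t = 1) :
    ∃ C : T → Clopens X, IsClopenPartition C ∧ (∀ t, μ.real (C t) = r t) ∧
      ∀ t, (g : X ≃ₜ X) '' C t = C (ρ t) := by
  obtain ⟨E, hE, hEr⟩ := hμ.exists_partition r hr hsum
  let P : FinitePartialIso μ := .ofIndexed E (E ∘ ρ) hE (hE.comp_perm ρ) fun t => by
    simp only [Function.comp_apply, hEr, hρ]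
  obtain ⟨f, hf⟩ := exists_extends hX hμ P
  obtain ⟨_, hP, hconj⟩ := hg.inter_open_nonempty _ (isOpen_setOf_extends P) ⟨f, hf⟩
  obtain ⟨k, rfl⟩ := isConj_iff.1 hconj
  let C : T → Clopens X := fun t =>
    ⟨(k : X ≃ₜ X) ⁻¹' E t, (E t).isClopen.preimage (k : X ≃ₜ X).continuous⟩
  have hkC : ∀ t, (k : X ≃ₜ X) '' C t = E t := fun t =>
    (k : X ≃ₜ X).surjective.image_preimage _
  refine ⟨C, ?_, fun t => ?_, fun t => ?_⟩
  · refine ⟨fun i j hij => Clopens.disjoint_iff_forall.2 fun x hi hj =>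
      Clopens.disjoint_iff_forall.1 (hE.disjoint i j hij) _ hi hj, fun x => ?_⟩
    exact hE.exhaustive ((k : X ≃ₜ X) x)
  · rw [← measureReal_image_eq k, hkC, hEr]
  · have h1 := FinitePartialIso.extends_ofIndexed_iff.1 hP t
    rw [← hkC t, coe_conj_image] at h1
    exact (k : X ≃ₜ X).injective.image_injective (h1.trans (hkC (ρ t)).symm)

/-- The measures of the intersections of the pieces of two partitions that are permuted by the same
measure-preserving homeomorphism form an invariant joining. -/
theorem HasDenseConjugacyClass.hasInvariantJoinings.{u, v} [BorelSpace X] (hX : IsCantorSpace X)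
    (hμ : IsGoodMeasure μ) (hμV : clopenValueSet μ = V)
    (h : HasDenseConjugacyClass (preservingHomeo μ)) : HasInvariantJoinings.{u, v} V := by
  intro ι κ _ _ σ τ a b ha hb hσ hτ hsa hsb
  have := hμ.isProbability
  obtain ⟨g, hg⟩ := h
  subst hμV
  obtain ⟨C, hC, hCa, hCσ⟩ := exists_partition_of_dense_conjugatesOf hX hμ hg σ a ha hσ hsa
  obtain ⟨D, hD, hDb, hDτ⟩ := exists_partition_of_dense_conjugatesOf hX hμ hg τ b hb hτ hsb
  refine ⟨fun x y => μ.real (C x ∩ D y), fun x y => ⟨_, (C x).isClopen.inter (D y).isClopen, rfl⟩,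
    fun x y => ?_, fun x => ?_, fun y => ?_⟩
  · beta_reduce
    rw [← hCσ, ← hDτ, ← image_inter (g : X ≃ₜ X).injective, measureReal_image_eq]
  · rw [hD.sum_measureReal_inter μ (C x).isOpen.measurableSet, hCa]
  · simp only [inter_comm (C _ : Set X)]
    rw [hC.sum_measureReal_inter μ (D y).isOpen.measurableSet, hDb]

end MainArgument

theorem mainTheorem5 (V : Set ℝ) (hV : IsGroupLike V) :
    (∀ (X : Type*) [TopologicalSpace X] [MeasurableSpace X] [BorelSpace X] (μ : Measure X),
      IsCantorSpace X → IsGoodMeasure μ → clopenValueSet μ = V →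
        (HasDenseConjugacyClass (preservingHomeo μ) ↔ LcmCondition V)) ∧
    ((∃ W : Submodule ℚ ℝ, (W : Set ℝ) = addInt V) → LcmCondition V) ∧
    ((∃ R : Subring ℝ, (R : Set ℝ) = addInt V) → LcmCondition V) := by
  refine ⟨fun X _ _ _ μ hX hμ hμV => ⟨fun h => ?_, fun h => ?_⟩,
    fun ⟨W, hW⟩ => .of_rat_submodule hV W hW, fun ⟨R, hR⟩ => .of_subring hV R hR⟩
  · exact (h.hasInvariantJoinings hX hμ hμV).lcmCondition hV
  · exact (HasInvariantJoinings.of_lcmCondition hV.zero_mem h).hasDenseConjugacyClass hX hV hμ hμV
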